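/- **Setting.** A broadcast channel (BC) $Q_{Y_1,Y_2|X}$ has finite alphabets; rates and information quantities are in bits. Let $\mathcal R_{\mathrm{NS}}$ (the region of the unrestricted cooperation protocol, without secrecy and without a common message) be the union, over all finite alphabets $\mathcal U_0,\mathcal U_1,\mathcal U_2$ and all PMFs $Q_{U_0,U_1,U_2,X}$, each inducing the joint law $Q_{U_0,U_1,U_2,X}Q_{Y_1,Y_2|X}$, of the triples $(R_{12},R_1,R_2)\in\mathbb R_+^3$ with $$R_1\le I(U_0,U_1;Y_1),\qquad(1)$$ $$R_2\le I(U_0,U_2;Y_2)+R_{12},$$ $$R_1+R_2\le I(U_0,U_1;Y_1)+I(U_2;Y_2|U_0)-I(U_1;U_2|U_0),$$ $$R_1+R_2\le I(U_1;Y_1|U_0)+I(U_0,U_2;Y_2)-I(U_1;U_2|U_0)+R_{12}.$$ Let $\tilde{\mathcal R}_{\mathrm{NS}}$ (the region of the restricted protocol, in which the cooperation link carries no information about user 1's private message) be defined in the same way with (1) replaced by $$R_1\le I(U_1;Y_1|U_0)+\min\big\{0,\;I(U_2;Y_2|U_0)-I(U_1;U_2|U_0)\big\}.$$ If the channel input is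 subject to a constraint, the unions are restricted to PMFs for which the law of $X$ satisfies it. A binary *semi-orthogonal* BC has input $X=(X_1,X_2)\in\{0,1\}^2$; $Y_1$ is the output of a BSC with crossover probability $0.1$ and input $X_1$, and $Y_2\in\{0,1\}$ is, conditionally independently, the output of a channel $Q_{Y_2|X_1,X_2}$. Let $H_2$ be the binary entropy function and $c=1-H_2(0.1)$. The *binary dirty-paper (BDP) channel* with noise level $\varepsilon\in[0,\frac12]$ is $Y_2=X_2\oplus X_1\oplus Z$, with $Z\sim\mathrm{Ber}(\varepsilon)$ independent of $(X_1,X_2)$, and its input is constrained by $\mathbb P(X_2=1)\le q$, $q\in[0,\frac12]$. With state $X_1\sim\mathrm{Ber}(\frac12)$ and over all finite-valued $V$ and all joint laws of $(V,X_1,X_2)$ with this state law, $\mathbb P(X_2=1)\le q$ and $V-(X_1,X_2)-Y_2$, put $$C_{\mathrm{GP}}(\varepsilon,q)=\sup\{I(V;Y_2)-I(V;X_1)\},\qquad C_{\mathrm{F\text{-}CSI}}(\varepsilon,q)=\sup I(V;Y_2|X_1)$$ (the Gelfand–Pinsker capacity and the capacity with full channel state information). **Proposition (restricted cooperation is sub-optimal).**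 1. There exist BCs with $\tilde{\mathcal R}_{\mathrm{NS}}\subsetneq\mathcal R_{\mathrm{NS}}$; such a BC exists among the binary semi-orthogonal BCs, without any input constraint. 2. Consider the semi-orthogonal BC whose channel to user 2 is the BDP channel with $\varepsilon,q\in[0,\frac12]$, under the input constraint $\mathbb P(X_2=1)\le q$. For $R_{12}=c$, the largest $R_1$ in $\tilde{\mathcal R}_{\mathrm{NS}}$ and the largest $R_1$ in $\mathcal R_{\mathrm{NS}}$ both equal $c$. If $(c,c,R_2)\in\tilde{\mathcal R}_{\mathrm{NS}}$, then $R_2\le C_{\mathrm{GP}}(\varepsilon,q)$, whereas $(c,c,C_{\mathrm{F\text{-}CSI}}(\varepsilon,q))\in\mathcal R_{\mathrm{NS}}$. 3. There are $\varepsilon,q\in[0,\frac12]$ such that $C_{\mathrm{GP}}(\varepsilon,q)<C_{\mathrm{F\text{-}CSI}}(\varepsilon,q)$, and for the BC of part 2 with these parameters $\tilde{\mathcal R}_{\mathrm{NS}}\subsetneq\mathcal R_{\mathrm{NS}}$ and $$\sup\{R_2:(c,c,R_2)\in\tilde{\mathcal R}_{\mathrm{NS}}\}<\sup\{R_2:(c,c,R_2)\in\mathcal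 R_{\mathrm{NS}}\}.$$ -/

import Mathlib

namespace CoopBC

noncomputable section

/-! ### Information measures on finite probability spaces (in bits)

A probability mass function on a finite set `Ω` is a point `p` of `stdSimplex ℝ Ω`; a random
variable is a function on `Ω`. -/

open Classical in
/-- The law of the random variable `f` under `p`. -/
def law {Ω α : Type*} [Fintype Ω] (p : Ω → ℝ) (f : Ω → α) : α → ℝ :=
  fun a => ∑ ω with f ω = a, p ω

/-- The Shannon entropy `H(f)`, in bits. -/
def entropy {Ω α : Type*} [Fintype Ω] [Fintype α] (p : Ω → ℝ) (f : Ω → α) : ℝ :=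
  ∑ a, Real.negMulLog (law p f a) / Real.log 2

/-- The mutual information `I(f; g)`, in bits. -/
def mutualInfo {Ω α β : Type*} [Fintype Ω] [Fintype α] [Fintype β] (p : Ω → ℝ)
    (f : Ω → α) (g : Ω → β) : ℝ :=
  entropy p f + entropy p g - entropy p (fun ω => (f ω, g ω))

/-- The conditional mutual information `I(f; g | h)`, in bits. -/
def condMutualInfo {Ω α β γ : Type*} [Fintype Ω] [Fintype α] [Fintype β] [Fintype γ]
    (p : Ω → ℝ) (f : Ω → α) (g : Ω → β) (h : Ω → γ) : ℝ :=
  entropy p (fun ω => (f ω, h ω)) + entropy p (fun ω => (g ω, h ω))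
    - entropy p (fun ω => (f ω, g ω, h ω)) - entropy p h

/-! ### Channels -/

/-- A discrete memoryless channel: `prob x` is the law of the output when the input is `x`. -/
structure Channel (𝒳 𝒴 : Type*) [Fintype 𝒴] where
  prob : 𝒳 → 𝒴 → ℝ
  mem_stdSimplex : ∀ x, prob x ∈ stdSimplex ℝ 𝒴

/-- The joint law of `(T, X, Y)` when `(T, X)` has law `P` and `Y` is the output of the channel
`Q` for the input `X`; in particular `T - X - Y` is a Markov chain. -/
def jointLaw {T 𝒳 𝒴 : Type*} [Fintype 𝒴] (P : T × 𝒳 → ℝ) (Q : Channel 𝒳 𝒴) :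
    T × 𝒳 × 𝒴 → ℝ :=
  fun ω => P (ω.1, ω.2.1) * Q.prob ω.2.1 ω.2.2

/-! ### The two rate regions of a cooperative broadcast channel

A broadcast channel is a channel with input alphabet `𝒳` and output alphabet `𝒴₁ × 𝒴₂`.
Outcomes are of the form `ω = ((u₀, u₁, u₂), x, (y₁, y₂))`; a rate triple is `(R₁₂, R₁, R₂)`. -/

section Regions

variable {𝒰₀ 𝒰₁ 𝒰₂ 𝒳 𝒴₁ 𝒴₂ : Type*} [Fintype 𝒰₀] [Fintype 𝒰₁] [Fintype 𝒰₂]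
  [Fintype 𝒳] [Fintype 𝒴₁] [Fintype 𝒴₂]

/-- The rate bounds that the two cooperation protocols have in common:
`R₂ ≤ I(U₀,U₂;Y₂) + R₁₂`,
`R₁ + R₂ ≤ I(U₀,U₁;Y₁) + I(U₂;Y₂|U₀) - I(U₁;U₂|U₀)`,
`R₁ + R₂ ≤ I(U₁;Y₁|U₀) + I(U₀,U₂;Y₂) - I(U₁;U₂|U₀) + R₁₂`. -/
def CommonBounds (p : (𝒰₀ × 𝒰₁ × 𝒰₂) × 𝒳 × (𝒴₁ × 𝒴₂) → ℝ) (R₁₂ R₁ R₂ : ℝ) : Prop :=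
  R₂ ≤ mutualInfo p (fun ω => (ω.1.1, ω.1.2.2)) (fun ω => ω.2.2.2) + R₁₂ ∧
  R₁ + R₂ ≤ mutualInfo p (fun ω => (ω.1.1, ω.1.2.1)) (fun ω => ω.2.2.1)
      + condMutualInfo p (fun ω => ω.1.2.2) (fun ω => ω.2.2.2) (fun ω => ω.1.1)
      - condMutualInfo p (fun ω => ω.1.2.1) (fun ω => ω.1.2.2) (fun ω => ω.1.1) ∧
  R₁ + R₂ ≤ condMutualInfo p (fun ω => ω.1.2.1) (fun ω => ω.2.2.1) (fun ω => ω.1.1)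
      + mutualInfo p (fun ω => (ω.1.1, ω.1.2.2)) (fun ω => ω.2.2.2)
      - condMutualInfo p (fun ω => ω.1.2.1) (fun ω => ω.1.2.2) (fun ω => ω.1.1) + R₁₂

/-- The bound on `R₁` of the unrestricted protocol: `R₁ ≤ I(U₀,U₁;Y₁)`. -/
def UnrestrictedBound (p : (𝒰₀ × 𝒰₁ × 𝒰₂) × 𝒳 × (𝒴₁ × 𝒴₂) → ℝ) (R₁ : ℝ) : Prop :=
  R₁ ≤ mutualInfo p (fun ω => (ω.1.1, ω.1.2.1)) (fun ω => ω.2.2.1)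

/-- The bound on `R₁` of the restricted protocol:
`R₁ ≤ I(U₁;Y₁|U₀) + min{0, I(U₂;Y₂|U₀) - I(U₁;U₂|U₀)}`. -/
def RestrictedBound (p : (𝒰₀ × 𝒰₁ × 𝒰₂) × 𝒳 × (𝒴₁ × 𝒴₂) → ℝ) (R₁ : ℝ) : Prop :=
  R₁ ≤ condMutualInfo p (fun ω => ω.1.2.1) (fun ω => ω.2.2.1) (fun ω => ω.1.1)
      + min 0 (condMutualInfo p (fun ω => ω.1.2.2) (fun ω => ω.2.2.2) (fun ω => ω.1.1)
        - condMutualInfo p (fun ω => ω.1.2.1) (fun ω => ω.1.2.2) (fun ω => ω.1.1))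

/-- The region of the unrestricted protocol for the broadcast channel `Q`, when the law of the
channel input has to lie in `A` (`A = Set.univ`: no input constraint): the union, over all finite
auxiliary alphabets and all laws `P` of `(U₀, U₁, U₂, X)`, of the triples of nonnegative rates
that satisfy the bounds. -/
def regionNS (Q : Channel 𝒳 (𝒴₁ × 𝒴₂)) (A : Set (𝒳 → ℝ)) : Set (ℝ × ℝ × ℝ) :=
  {R | 0 ≤ R.1 ∧ 0 ≤ R.2.1 ∧ 0 ≤ R.2.2 ∧
    ∃ (𝒰₀ 𝒰₁ 𝒰₂ : Type) (_ : Fintype 𝒰₀) (_ : Fintype 𝒰₁) (_ : Fintype 𝒰₂)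
      (P : (𝒰₀ × 𝒰₁ × 𝒰₂) × 𝒳 → ℝ),
      P ∈ stdSimplex ℝ ((𝒰₀ × 𝒰₁ × 𝒰₂) × 𝒳) ∧ law P Prod.snd ∈ A ∧
      UnrestrictedBound (jointLaw P Q) R.2.1 ∧
      CommonBounds (jointLaw P Q) R.1 R.2.1 R.2.2}

/-- The region of the restricted protocol, in which the cooperation link carries no information
about the first user's private message. -/
def restrictedRegionNS (Q : Channel 𝒳 (𝒴₁ × 𝒴₂)) (A : Set (𝒳 → ℝ)) : Set (ℝ × ℝ × ℝ) :=
  {R | 0 ≤ R.1 ∧ 0 ≤ R.2.1 ∧ 0 ≤ R.2.2 ∧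
    ∃ (𝒰₀ 𝒰₁ 𝒰₂ : Type) (_ : Fintype 𝒰₀) (_ : Fintype 𝒰₁) (_ : Fintype 𝒰₂)
      (P : (𝒰₀ × 𝒰₁ × 𝒰₂) × 𝒳 → ℝ),
      P ∈ stdSimplex ℝ ((𝒰₀ × 𝒰₁ × 𝒰₂) × 𝒳) ∧ law P Prod.snd ∈ A ∧
      RestrictedBound (jointLaw P Q) R.2.1 ∧
      CommonBounds (jointLaw P Q) R.1 R.2.1 R.2.2}

end Regions

/-! ### The binary semi-orthogonal broadcast channel -/

/-- The binary symmetric channel with crossover probability `ε`. -/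
def bsc (ε : ℝ) (hε : ε ∈ Set.Icc (0 : ℝ) (1 / 2)) : Channel Bool Bool where
  prob x y := if y = x then 1 - ε else ε
  mem_stdSimplex x := by
    obtain ⟨h0, h1⟩ := hε
    refine ⟨fun y => ?_, ?_⟩
    · dsimp only
      split_ifs <;> linarith
    · cases x <;> simp

/-- The binary dirty-paper channel `Y₂ = X₂ ⊕ X₁ ⊕ Z` with input `(X₁, X₂)` and noise
`Z ∼ Ber(ε)` independent of the input. -/
def dirtyPaper (ε : ℝ) (hε : ε ∈ Set.Icc (0 : ℝ) (1 / 2)) : Channel (Bool × Bool) Bool where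
  prob x := (bsc ε hε).prob (xor x.2 x.1)
  mem_stdSimplex x := (bsc ε hε).mem_stdSimplex (xor x.2 x.1)

/-- The semi-orthogonal broadcast channel with input `(X₁, X₂)`: `Y₁` is the output of a
`BSC(0.1)` with input `X₁`, and `Y₂` is the output of `K` with input `(X₁, X₂)`. -/
def semiOrthogonal (K : Channel (Bool × Bool) Bool) :
    Channel (Bool × Bool) (Bool × Bool) where
  prob x y := (bsc (1 / 10) (by norm_num)).prob x.1 y.1 * K.prob x y.2
  mem_stdSimplex x := by
    have h1 := (bsc (1 / 10) (by norm_num)).mem_stdSimplex x.1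
    have h2 := K.mem_stdSimplex x
    refine ⟨fun y => mul_nonneg (h1.1 _) (h2.1 _), ?_⟩
    rw [Fintype.sum_prod_type]
    simp_rw [← Finset.mul_sum, h2.2, mul_one]
    exact h1.2

/-- `c = 1 - H₂(0.1)`, the capacity of the `BSC(0.1)` in bits. -/
def bscCapacity : ℝ := 1 - Real.binEntropy (1 / 10) / Real.log 2

/-- The input laws of `(X₁, X₂)` whose expected Hamming weight of `X₂` is at most `q`. -/
def weightConstraint (q : ℝ) : Set (Bool × Bool → ℝ) :=
  {P | law P Prod.snd true ≤ q}

/-! ### Capacities of the state-dependent channel `K` with state `X₁ ∼ Ber(1/2)` and input `X₂`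

Outcomes are of the form `ω = (v, (x₁, x₂), y₂)`. -/

/-- `P` is a law of `(V, (X₁, X₂))` with `X₁ ∼ Ber(1/2)` and `ℙ(X₂ = 1) ≤ q`. -/
def IsStateLaw {𝒱 : Type} [Fintype 𝒱] (q : ℝ) (P : 𝒱 × (Bool × Bool) → ℝ) : Prop :=
  P ∈ stdSimplex ℝ (𝒱 × (Bool × Bool)) ∧
  (∀ s, law P (fun ω => ω.2.1) s = 1 / 2) ∧ law P Prod.snd ∈ weightConstraint q

/-- The Gelfand-Pinsker capacity (state known noncausally at the transmitter only):
the supremum of `I(V;Y₂) - I(V;X₁)`. -/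
def gelfandPinskerCapacity (K : Channel (Bool × Bool) Bool) (q : ℝ) : ℝ :=
  sSup {r | ∃ (𝒱 : Type) (_ : Fintype 𝒱) (P : 𝒱 × (Bool × Bool) → ℝ), IsStateLaw q P ∧
    r = mutualInfo (jointLaw P K) (fun ω => ω.1) (fun ω => ω.2.2)
      - mutualInfo (jointLaw P K) (fun ω => ω.1) (fun ω => ω.2.1.1)}

/-- The capacity with full state information (state known at both ends):
the supremum of `I(V;Y₂|X₁)`. -/
def fullCSICapacity (K : Channel (Bool × Bool) Bool) (q : ℝ) : ℝ :=
  sSup {r | ∃ (𝒱 : Type) (_ : Fintype 𝒱) (P : 𝒱 × (Bool × Bool) → ℝ), IsStateLaw q P ∧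
    r = condMutualInfo (jointLaw P K) (fun ω => ω.1) (fun ω => ω.2.2) (fun ω => ω.2.1.1)}

end

end CoopBC

/-! Everything turns on what `R₁ = c` forces. In the restricted protocol it gives `c ≤ I(U₁;Y₁|U₀) ≤
H(Y₁) - H(Y₁|U₀,U₁) ≤ 1 - H₂(0.1) = c`, so every inequality is tight. Tightness of the first kind
says that `Y₁`, hence `X₁`, is uniform given `U₀`. Tightness of the second kind says, by strict
concavity of the entropy, that `(U₀,U₁)` determines `X₁`. Put `V = (U₀,U₂)`. Then `I(V;X₁) =
I(U₂;X₁|U₀) ≤ I(U₁;U₂|U₀)` and `I(U₂;Y₂|U₀) ≤ I(V;Y₂)`, so the first sum-rate bound becomes `R₂ ≤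
I(V;Y₂) - I(V;X₁)`, a Gelfand-Pinsker rate (`exists_le_of_mem_restrictedRegionNS`). In the
unrestricted protocol `U₀ = X₁` is allowed: a link of rate `c` tells receiver 2 the state, and
`I(V;Y₂|X₁)` is achieved (`condMutualInfo_mem_regionNS`).

Strict inclusion thus reduces to a gap between the two capacities. Since `H(Y₂) ≤ 1 = H(X₁)`, a
Gelfand-Pinsker rate is at most the average over `v` of `H(X₁|V=v) - H(Y₂|V=v)`
(`gelfandPinsker_mul_log_two_le`), and it suffices to bound this function of the conditional law.

For the dirty-paper channel, let `s` and `t` be the conditional probabilities of `X₁ = 1` and of `X₁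
⊕ X₂ = 1`, with `h` the binary entropy in nats. The term is `h(s) - h(ε ⋆ t)`, and `|s - t|` is at
most the conditional weight of `X₂`. By concavity the term lies strictly below the tangent at `q` of
`d ↦ h(ε ⋆ d) - h(ε)`, evaluated at `d = |s - t|`. Compactness makes the slack uniform, and
averaging an affine bound only involves `ℙ(X₂ = 1) ≤ q`. The value of the tangent at `q` is the
full-CSI capacity in nats, so the gap is strict (`gelfandPinskerCapacity_lt_fullCSICapacity`).

Without input constraint, the channel that replaces `X₂` by a fair coin when `X₁ = 1` does the job:
full CSI gives `1/2`, whereas the term is at most `h(s) - h(s/2) < (log 2)/2` by strict concavity.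
-/

namespace CoopBC

/-! ### Laws of random variables and the Shannon inequalities -/

section Basics

variable {Ω Ω' α β γ : Type*} [Fintype Ω] [Fintype Ω']

open Classical in
theorem law_eq_sum_ite (p : Ω → ℝ) (f : Ω → α) (a : α) :
    law p f a = ∑ ω, if f ω = a then p ω else 0 := by
  unfold law
  rw [Finset.sum_filter]

theorem law_nonneg {p : Ω → ℝ} (hp : ∀ ω, 0 ≤ p ω) (f : Ω → α) (a : α) : 0 ≤ law p f a :=
  Finset.sum_nonneg fun ω _ => hp ω

theorem law_law (p : Ω → ℝ) (G : Ω → Ω') (f : Ω' → α) :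
    law (law p G) f = law p (fun ω => f (G ω)) := by
  classical
  funext a
  simp only [law_eq_sum_ite]
  have h (ω' : Ω') : (if f ω' = a then ∑ ω, (if G ω = ω' then p ω else 0) else 0)
      = ∑ ω, if G ω = ω' then (if f ω' = a then p ω else 0) else 0 := by
    by_cases h : f ω' = a <;> simp [h]
  rw [Finset.sum_congr rfl fun ω' _ => h ω', Finset.sum_comm]
  simp

theorem law_comp_injective (p : Ω → ℝ) (f : Ω → α) {e : α → β} (he : e.Injective) (a : α) :
    law p (fun ω => e (f ω)) (e a) = law p f a := by
  classical
  simp only [law_eq_sum_ite, he.eq_iff]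

theorem law_comp_of_notMem_range (p : Ω → ℝ) (f : Ω → α) (e : α → β) (b : β)
    (hb : b ∉ Set.range e) : law p (fun ω => e (f ω)) b = 0 := by
  classical
  rw [law_eq_sum_ite]
  refine Finset.sum_eq_zero fun ω _ => if_neg fun h => hb ⟨_, h⟩

theorem sum_law_pair_right [Fintype β] (p : Ω → ℝ) (f : Ω → α) (g : Ω → β) (a : α) :
    ∑ b, law p (fun ω => (f ω, g ω)) (a, b) = law p f a := by
  classical
  simp only [law_eq_sum_ite]
  rw [Finset.sum_comm]
  refine Finset.sum_congr rfl fun ω _ => ?_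
  by_cases h : f ω = a <;> simp [h]

theorem sum_law_pair_left [Fintype α] (p : Ω → ℝ) (f : Ω → α) (g : Ω → β) (b : β) :
    ∑ a, law p (fun ω => (f ω, g ω)) (a, b) = law p g b := by
  classical
  simp only [law_eq_sum_ite]
  rw [Finset.sum_comm]
  refine Finset.sum_congr rfl fun ω _ => ?_
  by_cases h : g ω = b <;> simp [h]

theorem law_pair_le_left [Fintype β] {p : Ω → ℝ} (hp : ∀ ω, 0 ≤ p ω) (f : Ω → α) (g : Ω → β) (a : α)
    (b : β) : law p (fun ω => (f ω, g ω)) (a, b) ≤ law p f a := by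
  rw [← sum_law_pair_right p f g]
  exact Finset.single_le_sum (f := fun b => law p (fun ω => (f ω, g ω)) (a, b))
    (fun b _ => law_nonneg hp _ _) (Finset.mem_univ b)

theorem law_pair_le_right [Fintype α] {p : Ω → ℝ} (hp : ∀ ω, 0 ≤ p ω) (f : Ω → α) (g : Ω → β) (a : α)
    (b : β) : law p (fun ω => (f ω, g ω)) (a, b) ≤ law p g b := by
  rw [← sum_law_pair_left p f g]
  exact Finset.single_le_sum (f := fun a => law p (fun ω => (f ω, g ω)) (a, b))
    (fun b _ => law_nonneg hp _ _) (Finset.mem_univ a)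

variable [Fintype α] [Fintype β] [Fintype γ]

theorem sum_law (p : Ω → ℝ) (f : Ω → α) : ∑ a, law p f a = ∑ ω, p ω := by
  classical
  simp only [law_eq_sum_ite]
  rw [Finset.sum_comm]
  simp

theorem law_mem_stdSimplex {p : Ω → ℝ} (hp : p ∈ stdSimplex ℝ Ω) (f : Ω → α) :
    law p f ∈ stdSimplex ℝ α :=
  ⟨law_nonneg hp.1 f, (sum_law p f).trans hp.2⟩

theorem entropy_law (p : Ω → ℝ) (G : Ω → Ω') (f : Ω' → α) :
    entropy (law p G) f = entropy p (fun ω => f (G ω)) := by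
  unfold entropy
  rw [law_law]

/-- Relabelling a random variable injectively does not change its entropy. -/
theorem entropy_comp_injective (p : Ω → ℝ) (f : Ω → α) {e : α → β} (he : e.Injective) :
    entropy p (fun ω => e (f ω)) = entropy p f := by
  unfold entropy
  symm
  refine Finset.sum_of_injOn e he.injOn (by simp) (fun b _ hb => ?_) (fun a _ => ?_)
  · rw [law_comp_of_notMem_range p f e b (by simpa using hb)]
    simp
  · rw [law_comp_injective p f he]

theorem entropy_swap (p : Ω → ℝ) (f : Ω → α) (g : Ω → β) :
    entropy p (fun ω => (f ω, g ω)) = entropy p (fun ω => (g ω, f ω)) :=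
  entropy_comp_injective p (fun ω => (g ω, f ω)) (e := Prod.swap) Prod.swap_injective

/-- The entropy in nats. -/
theorem entropy_mul_log_two (p : Ω → ℝ) (f : Ω → α) :
    entropy p f * Real.log 2 = ∑ a, Real.negMulLog (law p f a) := by
  have : Real.log 2 ≠ 0 := (Real.log_pos one_lt_two).ne'
  rw [entropy, Finset.sum_mul]
  exact Finset.sum_congr rfl fun a _ => div_mul_cancel₀ _ this

theorem entropy_le_entropy_pair {p : Ω → ℝ} (hp : ∀ ω, 0 ≤ p ω) (f : Ω → α) (g : Ω → β) :
    entropy p f ≤ entropy p (fun ω => (f ω, g ω)) := by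
  have hl : 0 < Real.log 2 := Real.log_pos one_lt_two
  rw [← mul_le_mul_iff_left₀ hl, entropy_mul_log_two, entropy_mul_log_two, Fintype.sum_prod_type]
  refine Finset.sum_le_sum fun a _ => ?_
  have h1 : Real.negMulLog (law p f a)
      = ∑ b, -(law p (fun ω => (f ω, g ω)) (a, b) * Real.log (law p f a)) := by
    rw [Finset.sum_neg_distrib, ← Finset.sum_mul, sum_law_pair_right, Real.negMulLog, neg_mul]
  rw [h1]
  refine Finset.sum_le_sum fun b _ => ?_
  rw [Real.negMulLog, neg_mul, neg_le_neg_iff]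
  have h0 := law_nonneg hp (fun ω => (f ω, g ω)) (a, b)
  rcases h0.eq_or_lt with h | h
  · rw [← h]; simp
  · refine mul_le_mul_of_nonneg_left (Real.log_le_log h ?_) h0
    exact law_pair_le_left hp f g a b

/-- This is `log u ≤ u - 1` at `u = yz/(xw)`, multiplied by `x`; it is the termwise form of
submodularity. The domination hypotheses make the other masses positive as soon as `x` is. -/
theorem mul_log_add_le {x y z w : ℝ} (hx : 0 ≤ x) (hxy : x ≤ y) (hxz : x ≤ z) (hyw : y ≤ w) :
    x * Real.log y + x * Real.log z - x * Real.log x - x * Real.log w ≤ y * z / w - x := by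
  rcases hx.eq_or_lt with rfl | hx
  · simp only [zero_mul, sub_zero, add_zero]
    exact div_nonneg (mul_nonneg hxy hxz) (hxy.trans hyw)
  have hy := hx.trans_le hxy
  have hz := hx.trans_le hxz
  have hw := hy.trans_le hyw
  have h := Real.log_le_sub_one_of_pos (x := y * z / (x * w)) (by positivity)
  rw [Real.log_div (by positivity) (by positivity), Real.log_mul hy.ne' hz.ne',
    Real.log_mul hx.ne' hw.ne'] at h
  have h2 := mul_le_mul_of_nonneg_left h hx.le
  have h3 : x * (y * z / (x * w) - 1) = y * z / w - x := by field_simp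
  linarith

/-- Submodularity of entropy. -/
theorem entropy_submodular {p : Ω → ℝ} (hp : ∀ ω, 0 ≤ p ω) (f : Ω → α) (g : Ω → β)
    (h : Ω → γ) :
    entropy p (fun ω => (f ω, g ω, h ω)) + entropy p h
      ≤ entropy p (fun ω => (f ω, h ω)) + entropy p (fun ω => (g ω, h ω)) := by
  have hl : 0 < Real.log 2 := Real.log_pos one_lt_two
  rw [← mul_le_mul_iff_left₀ hl, add_mul, add_mul, entropy_mul_log_two, entropy_mul_log_two,
    entropy_mul_log_two, entropy_mul_log_two, Fintype.sum_prod_type, Fintype.sum_prod_type,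
    Fintype.sum_prod_type]
  simp only [Fintype.sum_prod_type, Real.negMulLog]
  set x : α → β → γ → ℝ := fun a b c => law p (fun ω => (f ω, g ω, h ω)) (a, b, c) with hx
  set y : α → γ → ℝ := fun a c => law p (fun ω => (f ω, h ω)) (a, c) with hy
  set z : β → γ → ℝ := fun b c => law p (fun ω => (g ω, h ω)) (b, c) with hz
  set w : γ → ℝ := fun c => law p h c with hw
  have hxz (b c) : ∑ a, x a b c = z b c := sum_law_pair_left p f (fun ω => (g ω, h ω)) (b, c)
  have hxy (a c) : ∑ b, x a b c = y a c := by
    rw [hy, hx]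
    simp only
    rw [← sum_law_pair_left p g (fun ω => (f ω, h ω))]
    refine Finset.sum_congr rfl fun b _ => ?_
    exact (law_comp_injective p (fun ω => (f ω, g ω, h ω))
      (e := fun t => (t.2.1, t.1, t.2.2)) (fun s t hst => by
        simp only [Prod.mk.injEq] at hst; ext <;> simp [hst]) (a, b, c)).symm
  have hyw (c) : ∑ a, y a c = w c := sum_law_pair_left p f h c
  have hzw (c) : ∑ b, z b c = w c := sum_law_pair_left p g h c
  have hcomm (F : α → β → γ → ℝ) : ∑ a, ∑ b, ∑ c, F a b c = ∑ c, ∑ a, ∑ b, F a b c :=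
    (Finset.sum_congr rfl fun a _ => Finset.sum_comm).trans Finset.sum_comm
  -- The right-hand side sums to `0`, because `yz/w` and `x` have the same total mass. The left-hand
  -- side sums to the combination of entropies.
  have key : ∑ a, ∑ b, ∑ c, (x a b c * Real.log (y a c) + x a b c * Real.log (z b c)
      - x a b c * Real.log (x a b c) - x a b c * Real.log (w c))
      ≤ ∑ a, ∑ b, ∑ c, (y a c * z b c / w c - x a b c) := by
    refine Finset.sum_le_sum fun a _ => Finset.sum_le_sum fun b _ => Finset.sum_le_sum fun c _ =>
      mul_log_add_le (law_nonneg hp _ _) ?_ ?_ ?_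
    · rw [← hxy]
      exact Finset.single_le_sum (f := fun b => x a b c) (fun b _ => law_nonneg hp _ _)
        (Finset.mem_univ b)
    · exact law_pair_le_right hp f (fun ω => (g ω, h ω)) a (b, c)
    · exact law_pair_le_right hp f h a c
  have e1 : ∑ a, ∑ b, ∑ c, x a b c * Real.log (y a c) = ∑ a, ∑ c, y a c * Real.log (y a c) := by
    refine Finset.sum_congr rfl fun a _ => ?_
    rw [Finset.sum_comm]
    exact Finset.sum_congr rfl fun c _ => by rw [← Finset.sum_mul, hxy]
  have e2 : ∑ a, ∑ b, ∑ c, x a b c * Real.log (z b c) = ∑ b, ∑ c, z b c * Real.log (z b c) := by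
    rw [Finset.sum_comm]
    refine Finset.sum_congr rfl fun b _ => ?_
    rw [Finset.sum_comm]
    exact Finset.sum_congr rfl fun c _ => by rw [← Finset.sum_mul, hxz]
  have e3 : ∑ a, ∑ b, ∑ c, x a b c * Real.log (w c) = ∑ c, w c * Real.log (w c) := by
    rw [hcomm]
    refine Finset.sum_congr rfl fun c _ => ?_
    simp_rw [← Finset.sum_mul, hxy, hyw]
  have e4 : ∑ a, ∑ b, ∑ c, x a b c = ∑ c, w c := by
    rw [hcomm]
    refine Finset.sum_congr rfl fun c _ => ?_
    simp_rw [hxy, hyw]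
  have e5 : ∑ a, ∑ b, ∑ c, y a c * z b c / w c = ∑ c, w c := by
    rw [hcomm]
    refine Finset.sum_congr rfl fun c _ => ?_
    simp_rw [← Finset.sum_div, ← Finset.mul_sum, hzw, ← Finset.sum_mul, hyw]
    -- The identity `w * w / w = w` also holds for `w = 0`, so null values of the conditioning
    -- variable need no separate case.
    exact mul_self_div_self _
  simp only [Finset.sum_add_distrib, Finset.sum_sub_distrib, e1, e2, e3, e4, e5] at key
  simp only [neg_mul, Finset.sum_neg_distrib]
  linarith

theorem entropy_const {p : Ω → ℝ} (hp : ∑ ω, p ω = 1) (f : Ω → α) (a : α) (hf : ∀ ω, f ω = a) :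
    entropy p f = 0 := by
  classical
  refine Finset.sum_eq_zero fun b _ => ?_
  simp only [law_eq_sum_ite, hf]
  by_cases h : a = b <;> simp [h, hp]

theorem entropy_pair_le {p : Ω → ℝ} (hp : p ∈ stdSimplex ℝ Ω) (f : Ω → α) (g : Ω → β) :
    entropy p (fun ω => (f ω, g ω)) ≤ entropy p f + entropy p g := by
  have h := entropy_submodular hp.1 f g (fun _ => ())
  rw [entropy_const hp.2 (fun _ => ()) () (fun _ => rfl)] at h
  have h1 : entropy p (fun ω => (f ω, g ω, ())) = entropy p (fun ω => (f ω, g ω)) :=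
    entropy_comp_injective p (fun ω => (f ω, g ω)) (e := fun t => (t.1, t.2, ()))
      fun s t hst => by simpa [Prod.ext_iff] using hst
  have h2 : entropy p (fun ω => (f ω, ())) = entropy p f :=
    entropy_comp_injective p f (e := fun t => (t, ())) fun s t hst => by simpa using hst
  have h3 : entropy p (fun ω => (g ω, ())) = entropy p g :=
    entropy_comp_injective p g (e := fun t => (t, ())) fun s t hst => by simpa using hst
  linarith

end Basics

/-! ### Binary random variables -/

/-- The unnormalised binary entropy of the masses `x`, `y`, in nats. -/
noncomputable def pairEntropy (x y : ℝ) : ℝ :=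
  Real.negMulLog x + Real.negMulLog y - Real.negMulLog (x + y)

/-- `pairEntropy` is homogeneous of degree one. Conditional entropies of bits can therefore be
written as sums over joint masses, without conditional probabilities or divisions by zero. -/
theorem pairEntropy_eq {x y : ℝ} (hx : 0 ≤ x) (hy : 0 ≤ y) (h : 0 < x + y) :
    pairEntropy x y = (x + y) * Real.binEntropy (y / (x + y)) := by
  rw [Real.binEntropy_eq_negMulLog_add_negMulLog_one_sub]
  have h1 : 1 - y / (x + y) = x / (x + y) := by field_simp; ring
  rw [h1]
  have key (u : ℝ) (hu : 0 ≤ u) : (x + y) * Real.negMulLog (u / (x + y))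
      = Real.negMulLog u + u * Real.log (x + y) := by
    rcases hu.eq_or_lt with rfl | hu
    · simp
    · rw [Real.negMulLog, Real.negMulLog, Real.log_div hu.ne' h.ne']
      field_simp
      ring
  rw [mul_add, key y hy, key x hx, pairEntropy]
  simp only [Real.negMulLog]
  ring

theorem pairEntropy_zero_zero : pairEntropy 0 0 = 0 := by simp [pairEntropy]

/-- The binary convolution `(1 - ε) t + ε (1 - t)`. -/
noncomputable def bconv (ε t : ℝ) : ℝ := (1 - ε) * t + ε * (1 - t)

/-- Monotonicity on `[0, 1/2]` combined with the symmetry `u ↦ 1 - u`. -/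
theorem binEntropy_le_of_mem {ε u : ℝ} (hε : 0 ≤ ε) (hu : ε ≤ u) (hu' : u ≤ 1 - ε) :
    Real.binEntropy ε ≤ Real.binEntropy u := by
  rcases le_total u 2⁻¹ with h | h
  · exact Real.binEntropy_strictMonoOn.monotoneOn ⟨hε, hu.trans h⟩ ⟨hε.trans hu, h⟩ hu
  · rw [← Real.binEntropy_one_sub u]
    refine Real.binEntropy_strictMonoOn.monotoneOn ⟨hε, ?_⟩ ⟨?_, ?_⟩ ?_ <;> norm_num at h ⊢ <;>
      linarith

theorem binEntropy_lt_of_mem {ε u : ℝ} (hε : 0 ≤ ε) (hu : ε < u) (hu' : u < 1 - ε) :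
    Real.binEntropy ε < Real.binEntropy u := by
  rcases le_total u 2⁻¹ with h | h
  · exact Real.binEntropy_strictMonoOn ⟨hε, hu.le.trans h⟩ ⟨hε.trans hu.le, h⟩ hu
  · rw [← Real.binEntropy_one_sub u]
    refine Real.binEntropy_strictMonoOn ⟨hε, ?_⟩ ⟨?_, ?_⟩ ?_ <;> norm_num at h ⊢ <;>
      linarith

theorem pairEntropy_le {x y : ℝ} (hx : 0 ≤ x) (hy : 0 ≤ y) :
    pairEntropy x y ≤ (x + y) * Real.log 2 := by
  rcases (add_nonneg hx hy).eq_or_lt with h | h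
  · have : x = 0 := by linarith
    have : y = 0 := by linarith
    subst_vars; simp [pairEntropy_zero_zero]
  · rw [pairEntropy_eq hx hy h]
    exact mul_le_mul_of_nonneg_left Real.binEntropy_le_log_two h.le

theorem eq_of_pairEntropy_eq {x y : ℝ} (hx : 0 ≤ x) (hy : 0 ≤ y)
    (he : (x + y) * Real.log 2 ≤ pairEntropy x y) : x = y := by
  rcases (add_nonneg hx hy).eq_or_lt with h | h
  · linarith
  · rw [pairEntropy_eq hx hy h] at he
    have h1 := le_antisymm Real.binEntropy_le_log_two (le_of_mul_le_mul_left he h)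
    rw [Real.binEntropy_eq_log_two, div_eq_iff h.ne'] at h1
    linarith

/-- The normalised output of the channel is a mixture of `ε` and `1 - ε`, so its parameter stays in
`[ε, 1 - ε]`. -/
theorem le_pairEntropy_bsc {ε x y : ℝ} (hε : 0 ≤ ε) (hε' : ε ≤ 1 / 2) (hx : 0 ≤ x)
    (hy : 0 ≤ y) :
    (x + y) * Real.binEntropy ε ≤ pairEntropy ((1 - ε) * x + ε * y) (ε * x + (1 - ε) * y) := by
  have hs : (1 - ε) * x + ε * y + (ε * x + (1 - ε) * y) = x + y := by ring
  have h1 : 0 ≤ (1 - ε) * x + ε * y := by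
    have := mul_nonneg (sub_nonneg.2 (hε'.trans (by norm_num : (1 / 2 : ℝ) ≤ 1))) hx
    have := mul_nonneg hε hy
    linarith
  have h2 : 0 ≤ ε * x + (1 - ε) * y := by
    have := mul_nonneg (sub_nonneg.2 (hε'.trans (by norm_num : (1 / 2 : ℝ) ≤ 1))) hy
    have := mul_nonneg hε hx
    linarith
  rcases (add_nonneg hx hy).eq_or_lt with h | h
  · have : x = 0 := by linarith
    have : y = 0 := by linarith
    subst_vars; simp [pairEntropy_zero_zero]
  · rw [pairEntropy_eq h1 h2 (by linarith), hs]
    refine mul_le_mul_of_nonneg_left (binEntropy_le_of_mem hε ?_ ?_) h.le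
    · rw [le_div_iff₀ h]; nlinarith
    · rw [div_le_iff₀ h]; nlinarith

/-- If both input masses were positive, the output parameter would lie strictly between `ε` and `1 -
ε`, and the entropy would exceed that of the noise. -/
theorem eq_zero_of_pairEntropy_bsc_le {ε x y : ℝ} (hε : 0 ≤ ε) (hε' : ε < 1 / 2) (hx : 0 ≤ x)
    (hy : 0 ≤ y)
    (he : pairEntropy ((1 - ε) * x + ε * y) (ε * x + (1 - ε) * y) ≤ (x + y) * Real.binEntropy ε) :
    x = 0 ∨ y = 0 := by
  by_contra! hne
  have hx := hx.lt_of_ne' hne.1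
  have hy := hy.lt_of_ne' hne.2
  have hs : (1 - ε) * x + ε * y + (ε * x + (1 - ε) * y) = x + y := by ring
  have h := add_pos hx hy
  have h0 : 0 < 1 - ε := by linarith
  rw [pairEntropy_eq (by positivity) (by positivity) (by linarith), hs] at he
  refine he.not_gt (mul_lt_mul_of_pos_left (binEntropy_lt_of_mem hε ?_ ?_) h)
  · rw [lt_div_iff₀ h]; nlinarith
  · rw [div_lt_iff₀ h]; nlinarith

/-! ### Entropy added by a bit to another variable -/

section Binary

variable {Ω α : Type*} [Fintype Ω]

/-- `y` is the output of the binary symmetric channel with input `b`, given `f`. -/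
def IsBSCOutput (ε : ℝ) (p : Ω → ℝ) (f : Ω → α) (b y : Ω → Bool) : Prop :=
  ∀ a z, law p (fun ω => (f ω, y ω)) (a, z)
    = (1 - ε) * law p (fun ω => (f ω, b ω)) (a, z) + ε * law p (fun ω => (f ω, b ω)) (a, !z)

/-- The transition matrix has determinant `1 - 2ε ≠ 0`: a uniform output comes only from a uniform
input. -/
theorem IsBSCOutput.law_eq {ε : ℝ} (hε : ε ≠ 1 / 2) {p : Ω → ℝ} {f : Ω → α} {b y : Ω → Bool}
    (h : IsBSCOutput ε p f b y) (a : α)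
    (he : law p (fun ω => (f ω, y ω)) (a, false) = law p (fun ω => (f ω, y ω)) (a, true)) :
    law p (fun ω => (f ω, b ω)) (a, false) = law p (fun ω => (f ω, b ω)) (a, true) := by
  rw [h, h, Bool.not_false, Bool.not_true] at he
  have h2 : (1 - 2 * ε) ≠ 0 := fun h => hε (by linarith)
  apply mul_left_cancel₀ h2
  linarith

theorem law_pair_bool_add (p : Ω → ℝ) (f : Ω → α) (g : Ω → Bool) (a : α) :
    law p (fun ω => (f ω, g ω)) (a, false) + law p (fun ω => (f ω, g ω)) (a, true)
      = law p f a := by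
  rw [← sum_law_pair_right p f g a, Fintype.sum_bool, add_comm]

variable [Fintype α]

theorem entropy_pair_bool (p : Ω → ℝ) (f : Ω → α) (g : Ω → Bool) :
    entropy p (fun ω => (f ω, g ω)) * Real.log 2 = entropy p f * Real.log 2
      + ∑ a, pairEntropy (law p (fun ω => (f ω, g ω)) (a, false))
          (law p (fun ω => (f ω, g ω)) (a, true)) := by
  rw [entropy_mul_log_two, entropy_mul_log_two, Fintype.sum_prod_type, ← Finset.sum_add_distrib]
  refine Finset.sum_congr rfl fun a _ => ?_
  rw [← sum_law_pair_right p f g a]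
  simp only [Fintype.sum_bool, pairEntropy]
  rw [add_comm (law p (fun ω => (f ω, g ω)) (a, true))]
  ring

theorem law_bool_add {p : Ω → ℝ} (hp : ∑ ω, p ω = 1) (g : Ω → Bool) :
    law p g false + law p g true = 1 := by
  rw [← hp, ← sum_law p g, Fintype.sum_bool, add_comm]

theorem entropy_bool {p : Ω → ℝ} (hp : ∑ ω, p ω = 1) (g : Ω → Bool) :
    entropy p g * Real.log 2 = Real.binEntropy (law p g true) := by
  rw [entropy_mul_log_two, Fintype.sum_bool,
    Real.binEntropy_eq_negMulLog_add_negMulLog_one_sub, ← law_bool_add hp g]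
  simp

theorem entropy_bool_le_one {p : Ω → ℝ} (hp : ∑ ω, p ω = 1) (g : Ω → Bool) :
    entropy p g ≤ 1 := by
  have hl : 0 < Real.log 2 := Real.log_pos one_lt_two
  rw [← mul_le_mul_iff_left₀ hl, entropy_bool hp, one_mul]
  exact Real.binEntropy_le_log_two

theorem entropy_bool_eq_one {p : Ω → ℝ} (hp : ∑ ω, p ω = 1) (g : Ω → Bool)
    (h : law p g true = 1 / 2) : entropy p g = 1 := by
  have hl : 0 < Real.log 2 := Real.log_pos one_lt_two
  apply mul_right_cancel₀ hl.ne'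
  rw [entropy_bool hp, one_mul, h, one_div, Real.binEntropy_two_inv]

/-- A uniform bit that is independent of `f` adds one bit of entropy. -/
theorem entropy_pair_bool_of_eq {p : Ω → ℝ} (hp : p ∈ stdSimplex ℝ Ω) (f : Ω → α) (g : Ω → Bool)
    (h : ∀ a, law p (fun ω => (f ω, g ω)) (a, false) = law p (fun ω => (f ω, g ω)) (a, true)) :
    entropy p (fun ω => (f ω, g ω)) = entropy p f + 1 := by
  have hl : 0 < Real.log 2 := Real.log_pos one_lt_two
  apply mul_right_cancel₀ hl.ne'
  have key (x : ℝ) : pairEntropy x x = (x + x) * Real.log 2 := by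
    rcases eq_or_ne x 0 with rfl | hx
    · simp [pairEntropy_zero_zero]
    · rw [pairEntropy, ← two_mul x]
      simp only [Real.negMulLog]
      rw [Real.log_mul two_ne_zero hx]
      ring
  rw [entropy_pair_bool, add_mul, one_mul, add_right_inj]
  calc _ = ∑ a, law p f a * Real.log 2 := Finset.sum_congr rfl fun a _ => by
        rw [← law_pair_bool_add p f g a, h a, key]
    _ = Real.log 2 := by rw [← Finset.sum_mul, sum_law, hp.2, one_mul]

/-- A bit that is determined by `f` adds no entropy. -/
theorem entropy_pair_bool_of_mul_eq_zero (p : Ω → ℝ) (f : Ω → α)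
    (g : Ω → Bool) (h : ∀ a, law p (fun ω => (f ω, g ω)) (a, false) = 0 ∨
      law p (fun ω => (f ω, g ω)) (a, true) = 0) :
    entropy p (fun ω => (f ω, g ω)) = entropy p f := by
  have hl : 0 < Real.log 2 := Real.log_pos one_lt_two
  apply mul_right_cancel₀ hl.ne'
  rw [entropy_pair_bool, add_eq_left]
  refine Finset.sum_eq_zero fun a _ => ?_
  rcases h a with h | h <;> simp [h, pairEntropy]

/-- If a bit adds one bit of entropy to `f`, it is uniform conditionally on `f`. -/
theorem law_pair_bool_eq_of_entropy {p : Ω → ℝ} (hp : p ∈ stdSimplex ℝ Ω) (f : Ω → α)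
    (g : Ω → Bool) (h : entropy p f + 1 ≤ entropy p (fun ω => (f ω, g ω))) (a : α) :
    law p (fun ω => (f ω, g ω)) (a, false) = law p (fun ω => (f ω, g ω)) (a, true) := by
  have hl : 0 < Real.log 2 := Real.log_pos one_lt_two
  rw [← mul_le_mul_iff_left₀ hl, entropy_pair_bool, add_mul, one_mul, add_le_add_iff_left] at h
  have h0 (a : α) (b : Bool) := law_nonneg hp.1 (fun ω => (f ω, g ω)) (a, b)
  refine eq_of_pairEntropy_eq (h0 _ _) (h0 _ _) ?_
  have hsum : ∑ a, (law p (fun ω => (f ω, g ω)) (a, false)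
      + law p (fun ω => (f ω, g ω)) (a, true)) * Real.log 2 = Real.log 2 := by
    simp_rw [law_pair_bool_add]
    rw [← Finset.sum_mul, sum_law, hp.2, one_mul]
  have hle := fun a (_ : a ∈ Finset.univ) => pairEntropy_le (h0 a false) (h0 a true)
  -- A termwise inequality with equal sums is an equality in each term.
  have heq := (Finset.sum_eq_sum_iff_of_le hle).1
    (le_antisymm (Finset.sum_le_sum hle) (hsum.trans_le h))
  exact (heq a (Finset.mem_univ a)).ge

theorem IsBSCOutput.entropy_add_le {ε : ℝ} (hε : ε ∈ Set.Icc (0 : ℝ) (1 / 2)) {p : Ω → ℝ}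
    (hp : p ∈ stdSimplex ℝ Ω) {f : Ω → α} {b y : Ω → Bool} (h : IsBSCOutput ε p f b y) :
    entropy p f + Real.binEntropy ε / Real.log 2 ≤ entropy p (fun ω => (f ω, y ω)) := by
  have hl : 0 < Real.log 2 := Real.log_pos one_lt_two
  rw [← mul_le_mul_iff_left₀ hl, entropy_pair_bool, add_mul, div_mul_cancel₀ _ hl.ne',
    add_le_add_iff_left]
  calc Real.binEntropy ε = ∑ a, law p f a * Real.binEntropy ε := by
        rw [← Finset.sum_mul, sum_law, hp.2, one_mul]
    _ ≤ _ := Finset.sum_le_sum fun a _ => by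
        have h0 (c : Bool) := law_nonneg hp.1 (fun ω => (f ω, b ω)) (a, c)
        have := le_pairEntropy_bsc hε.1 hε.2 (h0 false) (h0 true)
        rw [← law_pair_bool_add p f b a, h, h]
        simpa [add_comm] using this

theorem IsBSCOutput.entropy_eq {ε : ℝ} (hε : ε ∈ Set.Icc (0 : ℝ) (1 / 2)) {p : Ω → ℝ}
    (hp : p ∈ stdSimplex ℝ Ω) {f : Ω → α} {b y : Ω → Bool} (h : IsBSCOutput ε p f b y)
    (hdet : ∀ a, law p (fun ω => (f ω, b ω)) (a, false) = 0 ∨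
      law p (fun ω => (f ω, b ω)) (a, true) = 0) :
    entropy p (fun ω => (f ω, y ω)) = entropy p f + Real.binEntropy ε / Real.log 2 := by
  have hl : 0 < Real.log 2 := Real.log_pos one_lt_two
  apply mul_right_cancel₀ hl.ne'
  rw [entropy_pair_bool, add_mul, div_mul_cancel₀ _ hl.ne', add_right_inj]
  have key (x : ℝ) (hx : 0 ≤ x) : pairEntropy ((1 - ε) * x) (ε * x) = x * Real.binEntropy ε := by
    have h1 : 0 ≤ 1 - ε := by linarith [hε.2]
    rcases hx.eq_or_lt with rfl | hx'
    · simp [pairEntropy_zero_zero]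
    · rw [pairEntropy_eq (by positivity) (mul_nonneg hε.1 hx) (by linarith)]
      have : (1 - ε) * x + ε * x = x := by ring
      rw [this, mul_div_cancel_right₀ _ hx'.ne']
  have hcomm (x y : ℝ) : pairEntropy x y = pairEntropy y x := by
    simp only [pairEntropy, add_comm]
  calc _ = ∑ a, law p f a * Real.binEntropy ε := Finset.sum_congr rfl fun a _ => by
        have h0 (c : Bool) := law_nonneg hp.1 (fun ω => (f ω, b ω)) (a, c)
        rw [← law_pair_bool_add p f b a, h, h]
        rcases hdet a with hd | hd
        · rw [hcomm]; simp [hd, key _ (h0 true)]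
        · simp [hd, key _ (h0 false)]
    _ = Real.binEntropy ε := by rw [← Finset.sum_mul, sum_law, hp.2, one_mul]

/-- The equality case of `IsBSCOutput.entropy_add_le`: if only the noise entropy remains given `f`,
then `f` determines the channel input. -/
theorem IsBSCOutput.eq_zero_or_eq_zero {ε : ℝ} (hε : ε ∈ Set.Ico (0 : ℝ) (1 / 2)) {p : Ω → ℝ}
    (hp : p ∈ stdSimplex ℝ Ω) {f : Ω → α} {b y : Ω → Bool} (h : IsBSCOutput ε p f b y)
    (he : entropy p (fun ω => (f ω, y ω)) ≤ entropy p f + Real.binEntropy ε / Real.log 2)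
    (a : α) :
    law p (fun ω => (f ω, b ω)) (a, false) = 0 ∨ law p (fun ω => (f ω, b ω)) (a, true) = 0 := by
  have hl : 0 < Real.log 2 := Real.log_pos one_lt_two
  rw [← mul_le_mul_iff_left₀ hl, entropy_pair_bool, add_mul, div_mul_cancel₀ _ hl.ne',
    add_le_add_iff_left] at he
  have h0 (a : α) (c : Bool) := law_nonneg hp.1 (fun ω => (f ω, b ω)) (a, c)
  have hle : ∀ a ∈ Finset.univ, law p f a * Real.binEntropy ε
      ≤ pairEntropy (law p (fun ω => (f ω, y ω)) (a, false))
        (law p (fun ω => (f ω, y ω)) (a, true)) := fun a _ => by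
    rw [← law_pair_bool_add p f b a, h, h]
    simpa [add_comm] using le_pairEntropy_bsc hε.1 hε.2.le (h0 a false) (h0 a true)
  have hsum : ∑ a, law p f a * Real.binEntropy ε = Real.binEntropy ε := by
    rw [← Finset.sum_mul, sum_law, hp.2, one_mul]
  have heq := (Finset.sum_eq_sum_iff_of_le hle).1
    (le_antisymm (Finset.sum_le_sum hle) (by rw [hsum]; exact he)) a (Finset.mem_univ a)
  refine eq_zero_of_pairEntropy_bsc_le hε.1 hε.2 (h0 a false) (h0 a true) ?_
  rw [law_pair_bool_add, heq, h, h]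
  simp [add_comm]

end Binary

/-! ### Joint laws -/

section JointLaw

variable {T T' 𝒳 𝒴 𝒴' α β : Type*} [Fintype T] [Fintype 𝒳] [Fintype 𝒴] [Fintype 𝒴']

theorem jointLaw_mem_stdSimplex {P : T × 𝒳 → ℝ} (hP : P ∈ stdSimplex ℝ (T × 𝒳))
    (Q : Channel 𝒳 𝒴) : jointLaw P Q ∈ stdSimplex ℝ (T × 𝒳 × 𝒴) := by
  refine ⟨fun ω => mul_nonneg (hP.1 _) ((Q.mem_stdSimplex _).1 _), ?_⟩
  simp only [jointLaw, Fintype.sum_prod_type, ← Finset.mul_sum, (Q.mem_stdSimplex _).2, mul_one]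
  rw [← hP.2, Fintype.sum_prod_type]

theorem law_jointLaw_pair (P : T × 𝒳 → ℝ) (Q : Channel 𝒳 𝒴) (f : T × 𝒳 → α) (g : 𝒴 → β)
    (a : α) (b : β) :
    law (jointLaw P Q) (fun ω => (f (ω.1, ω.2.1), g ω.2.2)) (a, b)
      = law (fun τ => P τ * law (Q.prob τ.2) g b) f a := by
  classical
  simp only [law_eq_sum_ite, jointLaw, Fintype.sum_prod_type, Prod.mk.injEq]
  refine Finset.sum_congr rfl fun t _ => Finset.sum_congr rfl fun x _ => ?_
  by_cases h : f (t, x) = a <;> simp [h, Finset.mul_sum]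

theorem law_jointLaw (P : T × 𝒳 → ℝ) (Q : Channel 𝒳 𝒴) (f : T × 𝒳 → α) :
    law (jointLaw P Q) (fun ω => f (ω.1, ω.2.1)) = law P f := by
  classical
  funext a
  simp only [law_eq_sum_ite, jointLaw, Fintype.sum_prod_type]
  refine Finset.sum_congr rfl fun t _ => Finset.sum_congr rfl fun x _ => ?_
  by_cases h : f (t, x) = a <;> simp [h, ← Finset.mul_sum, (Q.mem_stdSimplex _).2]

/-- Pushing the auxiliary variable and the channel output forward. -/
theorem jointLaw_law (P : T × 𝒳 → ℝ) (Q : Channel 𝒳 𝒴) (Q' : Channel 𝒳 𝒴') (φ : T × 𝒳 → T')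
    (g : 𝒴 → 𝒴') (h : ∀ x, Q'.prob x = law (Q.prob x) g) :
    jointLaw (law P fun τ => (φ τ, τ.2)) Q'
      = law (jointLaw P Q) fun ω => (φ (ω.1, ω.2.1), ω.2.1, g ω.2.2) := by
  classical
  funext ⟨t, x, y⟩
  have h1 := law_jointLaw_pair P Q (fun τ => (φ τ, τ.2)) g (t, x) y
  have h2 := law_comp_injective (jointLaw P Q)
    (fun ω => ((φ (ω.1, ω.2.1), ω.2.1), g ω.2.2)) (e := fun s => (s.1.1, s.1.2, s.2))
    (fun s s' hs => by simp only [Prod.mk.injEq] at hs; ext <;> simp [hs]) ((t, x), y)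
  refine Eq.trans ?_ (h1.symm.trans h2.symm)
  simp only [jointLaw, law_eq_sum_ite, h, Finset.sum_mul]
  refine Finset.sum_congr rfl fun τ _ => ?_
  by_cases h : (φ τ, τ.2) = (t, x)
  · have : τ.2 = x := (Prod.mk.inj h).2
    simp [this]
  · simp [h]

theorem isBSCOutput_jointLaw {ε : ℝ} (hε : ε ∈ Set.Icc (0 : ℝ) (1 / 2)) (P : T × 𝒳 → ℝ)
    (Q : Channel 𝒳 𝒴) (f : T × 𝒳 → α) (β : 𝒳 → Bool) (g : 𝒴 → Bool)
    (h : ∀ x, law (Q.prob x) g = (bsc ε hε).prob (β x)) :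
    IsBSCOutput ε (jointLaw P Q) (fun ω => f (ω.1, ω.2.1)) (fun ω => β ω.2.1)
      (fun ω => g ω.2.2) := by
  classical
  intro a z
  rw [law_jointLaw_pair, law_jointLaw P Q (fun τ => (f τ, β τ.2))]
  simp_rw [h]
  simp only [law_eq_sum_ite, bsc, Prod.mk.injEq, Finset.mul_sum, ← Finset.sum_add_distrib]
  refine Finset.sum_congr rfl fun τ _ => ?_
  by_cases h : f τ = a
  · cases z <;> cases hb : β τ.2 <;> simp [h, mul_comm]
  · simp [h]

end JointLaw

theorem law_semiOrthogonal_fst (K : Channel (Bool × Bool) Bool) (x : Bool × Bool) :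
    law ((semiOrthogonal K).prob x) Prod.fst = (bsc (1 / 10) (by norm_num)).prob x.1 := by
  classical
  funext z
  have h := (K.mem_stdSimplex x).2
  simp only [Fintype.sum_bool] at h
  simp only [law_eq_sum_ite, semiOrthogonal, Fintype.sum_prod_type, Fintype.sum_bool]
  cases z <;> simp [← mul_add, h]

theorem law_semiOrthogonal_snd (K : Channel (Bool × Bool) Bool) (x : Bool × Bool) :
    law ((semiOrthogonal K).prob x) Prod.snd = K.prob x := by
  classical
  funext z
  have h := ((bsc (1 / 10) (by norm_num)).mem_stdSimplex x.1).2
  simp only [Fintype.sum_bool] at h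
  simp only [law_eq_sum_ite, semiOrthogonal, Fintype.sum_prod_type, Fintype.sum_bool]
  cases z <;> simp [← add_mul, h, -one_div]

/-! ### Elementary properties of mutual information -/

section Information

variable {Ω α β γ : Type*} [Fintype Ω] [Fintype α] [Fintype β] [Fintype γ]

theorem law_id {Ω : Type*} [Fintype Ω] (p : Ω → ℝ) : law p (fun ω => ω) = p := by
  classical
  funext a
  simp [law_eq_sum_ite]

/-- Random variables that determine each other have the same entropy. -/
theorem entropy_eq_of_comp (p : Ω → ℝ) {f : Ω → α} {g : Ω → β} (e : α → β) (e' : β → α)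
    (h : ∀ ω, e (f ω) = g ω) (h' : ∀ ω, e' (g ω) = f ω) : entropy p f = entropy p g := by
  have h1 := entropy_comp_injective p f (e := fun a => (a, e a))
    fun s t hst => (Prod.mk.inj hst).1
  have h2 := entropy_comp_injective p g (e := fun a => (a, e' a))
    fun s t hst => (Prod.mk.inj hst).1
  simp only [h, h'] at h1 h2
  rw [← h1, ← h2, entropy_swap]

theorem mutualInfo_nonneg {p : Ω → ℝ} (hp : p ∈ stdSimplex ℝ Ω) (f : Ω → α) (g : Ω → β) :
    0 ≤ mutualInfo p f g :=
  sub_nonneg.2 (entropy_pair_le hp f g)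

theorem condMutualInfo_nonneg {p : Ω → ℝ} (hp : p ∈ stdSimplex ℝ Ω) (f : Ω → α) (g : Ω → β)
    (h : Ω → γ) : 0 ≤ condMutualInfo p f g h := by
  have := entropy_submodular hp.1 f g h
  unfold condMutualInfo
  linarith

/-- By the chain rule the difference of the two sides is `I(h;g) ≥ 0`. -/
theorem condMutualInfo_le_mutualInfo {p : Ω → ℝ} (hp : p ∈ stdSimplex ℝ Ω) (f : Ω → α)
    (g : Ω → β) (h : Ω → γ) :
    condMutualInfo p f g h ≤ mutualInfo p (fun ω => (h ω, f ω)) g := by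
  have h1 := entropy_pair_le hp g h
  have h2 : entropy p (fun ω => ((h ω, f ω), g ω)) = entropy p (fun ω => (f ω, g ω, h ω)) :=
    entropy_eq_of_comp p (fun x => (x.1.2, x.2, x.1.1)) (fun x => ((x.2.2, x.1), x.2.1))
      (fun _ => rfl) (fun _ => rfl)
  have h3 := entropy_swap p f h
  unfold condMutualInfo mutualInfo
  linarith

theorem mutualInfo_le_entropy {p : Ω → ℝ} (hp : ∀ ω, 0 ≤ p ω) (f : Ω → α) (g : Ω → β) :
    mutualInfo p f g ≤ entropy p g := by
  have := entropy_le_entropy_pair hp f g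
  unfold mutualInfo
  linarith

end Information

/-- Only the bounds on `R₁` differ, and `I(U₁;Y₁|U₀) + min{0, ·} ≤ I(U₀,U₁;Y₁)`, so the same input
law serves. -/
theorem restrictedRegionNS_subset {𝒳 𝒴₁ 𝒴₂ : Type*} [Fintype 𝒳] [Fintype 𝒴₁] [Fintype 𝒴₂]
    (Q : Channel 𝒳 (𝒴₁ × 𝒴₂)) (A : Set (𝒳 → ℝ)) : restrictedRegionNS Q A ⊆ regionNS Q A := by
  rintro R ⟨h0, h1, h2, 𝒰₀, 𝒰₁, 𝒰₂, _, _, _, P, hP, hA, hR, hC⟩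
  refine ⟨h0, h1, h2, 𝒰₀, 𝒰₁, 𝒰₂, _, _, _, P, hP, hA, hR.trans ?_, hC⟩
  have := condMutualInfo_le_mutualInfo (jointLaw_mem_stdSimplex hP Q) (fun ω => ω.1.2.1)
    (fun ω => ω.2.2.1) (fun ω => ω.1.1)
  refine le_trans ?_ this
  exact add_le_of_nonpos_right (min_le_left _ _)

theorem bscCapacity_nonneg : 0 ≤ bscCapacity := by
  have hl : 0 < Real.log 2 := Real.log_pos one_lt_two
  rw [bscCapacity, sub_nonneg, div_le_one hl]
  exact Real.binEntropy_le_log_two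

/-! ### The regions of the semi-orthogonal channel at full rate for user 1 -/

section SemiOrthogonal

variable {T α : Type*} [Fintype T] {K : Channel (Bool × Bool) Bool}
  {P : T × (Bool × Bool) → ℝ}

theorem isBSCOutput_semiOrthogonal (K : Channel (Bool × Bool) Bool) (P : T × (Bool × Bool) → ℝ)
    (f : T × (Bool × Bool) → α) :
    IsBSCOutput (1 / 10) (jointLaw P (semiOrthogonal K)) (fun ω => f (ω.1, ω.2.1))
      (fun ω => ω.2.1.1) (fun ω => ω.2.2.1) :=
  isBSCOutput_jointLaw (by norm_num) P (semiOrthogonal K) f Prod.fst Prod.fst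
    (law_semiOrthogonal_fst K)

-- One bit bounds `H(Y₁)`, and the noise entropy survives conditioning on anything that precedes the
-- channel.
variable [Fintype α] in
theorem mutualInfo_le_bscCapacity (hP : P ∈ stdSimplex ℝ (T × (Bool × Bool)))
    (f : T × (Bool × Bool) → α) :
    mutualInfo (jointLaw P (semiOrthogonal K)) (fun ω => f (ω.1, ω.2.1)) (fun ω => ω.2.2.1)
      ≤ bscCapacity := by
  have hp := jointLaw_mem_stdSimplex hP (semiOrthogonal K)
  have h1 := (isBSCOutput_semiOrthogonal K P f).entropy_add_le (by norm_num) hp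
  have h2 := entropy_bool_le_one hp.2 (fun ω => ω.2.2.1)
  unfold mutualInfo bscCapacity
  linarith

theorem mutualInfo_eq_bscCapacity (hP : P ∈ stdSimplex ℝ (T × (Bool × Bool)))
    (hX : ∀ s, law P (fun τ => τ.2.1) s = 1 / 2) :
    mutualInfo (jointLaw P (semiOrthogonal K)) (fun ω => ω.2.1.1) (fun ω => ω.2.2.1)
      = bscCapacity := by
  have hp := jointLaw_mem_stdSimplex hP (semiOrthogonal K)
  have hX' (s) : law (jointLaw P (semiOrthogonal K)) (fun ω => ω.2.1.1) s = 1 / 2 := by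
    rw [← hX s]
    exact congrFun (law_jointLaw P (semiOrthogonal K) (fun τ => τ.2.1)) s
  have h1 := (isBSCOutput_semiOrthogonal K P (fun τ => τ.2.1)).entropy_eq (by norm_num) hp
    (by
      classical
      intro a
      rcases a with - | -
      · right
        rw [law_eq_sum_ite]
        exact Finset.sum_eq_zero fun ω _ => if_neg (by simp)
      · left
        rw [law_eq_sum_ite]
        exact Finset.sum_eq_zero fun ω _ => if_neg (by simp))
  have h2 : entropy (jointLaw P (semiOrthogonal K)) (fun ω => ω.2.2.1) = 1 := by
    refine entropy_bool_eq_one hp.2 _ ?_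
    have h := isBSCOutput_semiOrthogonal K P (fun _ => ()) () true
    have e (g : T × (Bool × Bool) × (Bool × Bool) → Bool) (b : Bool) :
        law (jointLaw P (semiOrthogonal K)) (fun ω => ((), g ω)) ((), b)
          = law (jointLaw P (semiOrthogonal K)) g b :=
      law_comp_injective _ g (e := fun b => ((), b)) (fun s t h => (Prod.mk.inj h).2) b
    rw [e, e, e, hX', hX'] at h
    rw [h]
    norm_num
  unfold mutualInfo bscCapacity
  linarith

/-- In the unrestricted region: cooperation conveys the state to the second receiver. -/
theorem condMutualInfo_mem_regionNS {𝒱 : Type} [Fintype 𝒱] (K : Channel (Bool × Bool) Bool)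
    (A : Set (Bool × Bool → ℝ)) {P : 𝒱 × (Bool × Bool) → ℝ}
    (hP : P ∈ stdSimplex ℝ (𝒱 × (Bool × Bool))) (hX : ∀ s, law P (fun τ => τ.2.1) s = 1 / 2)
    (hA : law P Prod.snd ∈ A) :
    (bscCapacity, bscCapacity,
      condMutualInfo (jointLaw P K) (fun ω => ω.1) (fun ω => ω.2.2) (fun ω => ω.2.1.1))
        ∈ regionNS (semiOrthogonal K) A := by
  have hp := jointLaw_mem_stdSimplex hP (semiOrthogonal K)
  have hK := jointLaw_mem_stdSimplex hP K
  have hc := mutualInfo_eq_bscCapacity (K := K) hP hX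
  have e1 : jointLaw P K = law (jointLaw P (semiOrthogonal K))
      (fun ω => (ω.1, ω.2.1, ω.2.2.2)) := by
    rw [← jointLaw_law P (semiOrthogonal K) K (fun τ => τ.1) Prod.snd
      (fun x => (law_semiOrthogonal_snd K x).symm)]
    rw [law_id]
  have e2 := jointLaw_law P (semiOrthogonal K) (semiOrthogonal K)
    (fun τ => (τ.2.1, (), τ.1)) (fun y => y) (fun x => (law_id _).symm)
  -- The choice is `U₀ = X₁`, `U₁` trivial, `U₂ = V`. Then `I(U₁;U₂|U₀) = 0`, and the link rate `c =
  -- I(X₁;Y₁)` fills the last bound, where `I(U₁;Y₁|U₀)` vanishes.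
  refine ⟨bscCapacity_nonneg, bscCapacity_nonneg, condMutualInfo_nonneg hK _ _ _,
    Bool, Unit, 𝒱, _, _, _, law P fun τ => ((τ.2.1, (), τ.1), τ.2), law_mem_stdSimplex hP _,
    by rwa [law_law], ?_⟩
  rw [e1, e2]
  set p := jointLaw P (semiOrthogonal K)
  have r1 : entropy p (fun ω => (ω.2.1.1, ())) = entropy p (fun ω => ω.2.1.1) :=
    entropy_eq_of_comp p (fun x => x.1) (fun x => (x, ())) (fun _ => rfl) (fun _ => rfl)
  have r1' : entropy p (fun ω => ((), ω.2.1.1)) = entropy p (fun ω => ω.2.1.1) :=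
    entropy_eq_of_comp p (fun x => x.2) (fun x => ((), x)) (fun _ => rfl) (fun _ => rfl)
  have r2 : entropy p (fun ω => ((ω.2.1.1, ()), ω.2.2.1))
      = entropy p (fun ω => (ω.2.1.1, ω.2.2.1)) :=
    entropy_eq_of_comp p (fun x => (x.1.1, x.2)) (fun x => ((x.1, ()), x.2))
      (fun _ => rfl) (fun _ => rfl)
  have r3 : entropy p (fun ω => ((), ω.2.2.1, ω.2.1.1))
      = entropy p (fun ω => (ω.2.2.1, ω.2.1.1)) :=
    entropy_eq_of_comp p (fun x => x.2) (fun x => ((), x)) (fun _ => rfl) (fun _ => rfl)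
  have r4 : entropy p (fun ω => ((), ω.1, ω.2.1.1)) = entropy p (fun ω => (ω.1, ω.2.1.1)) :=
    entropy_eq_of_comp p (fun x => x.2) (fun x => ((), x)) (fun _ => rfl) (fun _ => rfl)
  have r5 := condMutualInfo_le_mutualInfo hp (fun ω => ω.1) (fun ω => ω.2.2.2)
    (fun ω => ω.2.1.1)
  simp only [UnrestrictedBound, CommonBounds, mutualInfo, condMutualInfo, entropy_law, r1, r1', r2,
    r3, r4] at hc r5 ⊢
  have := bscCapacity_nonneg
  refine ⟨?_, ?_, ?_, ?_⟩ <;> linarith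

/-- With `U₁ = X₁` and `U₀`, `U₂` trivial, all terms involving user 2 vanish, the minimum included.
This shows that `R₁ = c` is attained, and later that the set of possible `R₂` is nonempty. -/
theorem zero_mem_restrictedRegionNS {𝒱 : Type} [Fintype 𝒱] (K : Channel (Bool × Bool) Bool)
    (A : Set (Bool × Bool → ℝ)) {P : 𝒱 × (Bool × Bool) → ℝ}
    (hP : P ∈ stdSimplex ℝ (𝒱 × (Bool × Bool))) (hX : ∀ s, law P (fun τ => τ.2.1) s = 1 / 2)
    (hA : law P Prod.snd ∈ A) :
    (bscCapacity, bscCapacity, 0) ∈ restrictedRegionNS (semiOrthogonal K) A := by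
  have hp := jointLaw_mem_stdSimplex hP (semiOrthogonal K)
  have hc := mutualInfo_eq_bscCapacity (K := K) hP hX
  have e2 := jointLaw_law P (semiOrthogonal K) (semiOrthogonal K)
    (fun τ => ((), τ.2.1, ())) (fun y => y) (fun x => (law_id _).symm)
  refine ⟨bscCapacity_nonneg, bscCapacity_nonneg, le_rfl,
    Unit, Bool, Unit, _, _, _, law P fun τ => (((), τ.2.1, ()), τ.2), law_mem_stdSimplex hP _,
    by rwa [law_law], ?_⟩
  rw [e2]
  set p := jointLaw P (semiOrthogonal K)
  have r0 : entropy p (fun _ => ()) = 0 := entropy_const hp.2 _ () (fun _ => rfl)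
  have r0' : entropy p (fun _ => ((), ())) = 0 := entropy_const hp.2 _ ((), ()) (fun _ => rfl)
  have r1 : entropy p (fun ω => (ω.2.1.1, ())) = entropy p (fun ω => ω.2.1.1) :=
    entropy_eq_of_comp p (fun x => x.1) (fun x => (x, ())) (fun _ => rfl) (fun _ => rfl)
  have r1' : entropy p (fun ω => ((), ω.2.1.1)) = entropy p (fun ω => ω.2.1.1) :=
    entropy_eq_of_comp p (fun x => x.2) (fun x => ((), x)) (fun _ => rfl) (fun _ => rfl)
  have r2 : entropy p (fun ω => (ω.2.2.1, ())) = entropy p (fun ω => ω.2.2.1) :=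
    entropy_eq_of_comp p (fun x => x.1) (fun x => (x, ())) (fun _ => rfl) (fun _ => rfl)
  have r3 : entropy p (fun ω => (ω.2.1.1, ω.2.2.1, ()))
      = entropy p (fun ω => (ω.2.1.1, ω.2.2.1)) :=
    entropy_eq_of_comp p (fun x => (x.1, x.2.1)) (fun x => (x.1, x.2, ()))
      (fun _ => rfl) (fun _ => rfl)
  have r4 : entropy p (fun ω => (((), ω.2.1.1), ω.2.2.1))
      = entropy p (fun ω => (ω.2.1.1, ω.2.2.1)) :=
    entropy_eq_of_comp p (fun x => (x.1.2, x.2)) (fun x => (((), x.1), x.2))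
      (fun _ => rfl) (fun _ => rfl)
  have r5 : entropy p (fun ω => (ω.2.2.2, ())) = entropy p (fun ω => ω.2.2.2) :=
    entropy_eq_of_comp p (fun x => x.1) (fun x => (x, ())) (fun _ => rfl) (fun _ => rfl)
  have r6 : entropy p (fun ω => ((), ω.2.2.2, ())) = entropy p (fun ω => ω.2.2.2) :=
    entropy_eq_of_comp p (fun x => x.2.1) (fun x => ((), x, ())) (fun _ => rfl) (fun _ => rfl)
  have r7 : entropy p (fun ω => (((), ()), ω.2.2.2)) = entropy p (fun ω => ω.2.2.2) :=
    entropy_eq_of_comp p (fun x => x.2) (fun x => (((), ()), x)) (fun _ => rfl) (fun _ => rfl)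
  have r8 : entropy p (fun ω => (ω.2.1.1, (), ())) = entropy p (fun ω => ω.2.1.1) :=
    entropy_eq_of_comp p (fun x => x.1) (fun x => (x, (), ())) (fun _ => rfl) (fun _ => rfl)
  simp only [RestrictedBound, CommonBounds, mutualInfo, condMutualInfo, entropy_law, r0, r0', r1,
    r1', r2, r3, r4, r5, r6, r7, r8] at hc ⊢
  have := bscCapacity_nonneg
  refine ⟨?_, ?_, ?_, ?_⟩ <;> simp <;> linarith

/-- In the restricted region, the second user is served at most at a Gelfand-Pinsker rate when the
first user is served at full rate. -/
theorem exists_le_of_mem_restrictedRegionNS {A : Set (Bool × Bool → ℝ)} {r R₂ : ℝ}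
    (h : (r, bscCapacity, R₂) ∈ restrictedRegionNS (semiOrthogonal K) A) :
    ∃ (𝒱 : Type) (_ : Fintype 𝒱) (P : 𝒱 × (Bool × Bool) → ℝ),
      P ∈ stdSimplex ℝ (𝒱 × (Bool × Bool)) ∧ (∀ s, law P (fun τ => τ.2.1) s = 1 / 2) ∧
      law P Prod.snd ∈ A ∧
      R₂ ≤ mutualInfo (jointLaw P K) (fun ω => ω.1) (fun ω => ω.2.2)
        - mutualInfo (jointLaw P K) (fun ω => ω.1) (fun ω => ω.2.1.1) := by
  obtain ⟨-, -, -, 𝒰₀, 𝒰₁, 𝒰₂, _, _, _, P, hP, hA, hR, -, hC, -⟩ := h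
  have hp := jointLaw_mem_stdSimplex hP (semiOrthogonal K)
  have e1 := jointLaw_law P (semiOrthogonal K) K (fun τ => (τ.1.1, τ.1.2.2)) Prod.snd
    (fun x => (law_semiOrthogonal_snd K x).symm)
  have hX0 := law_jointLaw P (semiOrthogonal K) (fun τ => τ.2.1)
  have b0 : IsBSCOutput (1 / 10) (jointLaw P (semiOrthogonal K)) (fun ω => ω.1.1)
      (fun ω => ω.2.1.1) (fun ω => ω.2.2.1) :=
    isBSCOutput_semiOrthogonal K P (fun τ => τ.1.1)
  have b1 : IsBSCOutput (1 / 10) (jointLaw P (semiOrthogonal K)) (fun ω => (ω.1.1, ω.1.2.1))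
      (fun ω => ω.2.1.1) (fun ω => ω.2.2.1) :=
    isBSCOutput_semiOrthogonal K P (fun τ => (τ.1.1, τ.1.2.1))
  have hI : mutualInfo (jointLaw P (semiOrthogonal K)) (fun ω => (ω.1.1, ω.1.2.1))
      (fun ω => ω.2.2.1) ≤ bscCapacity :=
    mutualInfo_le_bscCapacity hP (fun τ => (τ.1.1, τ.1.2.1))
  set p := jointLaw P (semiOrthogonal K)
  -- Only the nonpositivity of the minimum is needed: `c ≤ I(U₁;Y₁|U₀)`, which is the start of the
  -- chain of inequalities that must all be tight.
  have hR' := hR.trans (add_le_of_nonpos_right (min_le_left _ _))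
  have s1 : entropy p (fun ω => (ω.1.2.1, ω.1.1)) = entropy p (fun ω => (ω.1.1, ω.1.2.1)) :=
    entropy_swap p _ _
  have s2 : entropy p (fun ω => (ω.1.2.1, ω.2.2.1, ω.1.1))
      = entropy p (fun ω => ((ω.1.1, ω.1.2.1), ω.2.2.1)) :=
    entropy_eq_of_comp p (fun x => ((x.2.2, x.1), x.2.1)) (fun x => (x.1.2, x.2, x.1.1))
      (fun _ => rfl) (fun _ => rfl)
  have s3 : entropy p (fun ω => (ω.2.2.1, ω.1.1)) = entropy p (fun ω => (ω.1.1, ω.2.2.1)) :=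
    entropy_swap p _ _
  have hy := entropy_pair_le hp (fun ω => ω.1.1) (fun ω => ω.2.2.1)
  have hy1 := entropy_bool_le_one hp.2 (fun ω => ω.2.2.1)
  have hb1 := b1.entropy_add_le (by norm_num) hp
  -- given `U₀`, the input `X₁` is uniform
  have hu := fun a => b0.law_eq (by norm_num) a <| law_pair_bool_eq_of_entropy hp _ _
    (by simp only [condMutualInfo, bscCapacity] at hR'; linarith) a
  -- `(U₀, U₁)` determines `X₁`
  have hd := b1.eq_zero_or_eq_zero (by norm_num) hp
    (by simp only [condMutualInfo, bscCapacity] at hR'; linarith)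
  have hXu : ∀ s, law p (fun ω => ω.2.1.1) s = 1 / 2 := by
    have h1 := law_bool_add hp.2 (fun ω => ω.2.1.1)
    have h2 : law p (fun ω => ω.2.1.1) false = law p (fun ω => ω.2.1.1) true := by
      rw [← sum_law_pair_left p (fun ω => ω.1.1) (fun ω => ω.2.1.1) false,
        ← sum_law_pair_left p (fun ω => ω.1.1) (fun ω => ω.2.1.1) true]
      exact Finset.sum_congr rfl fun a _ => hu a
    rintro (- | -) <;> linarith
  -- The Gelfand-Pinsker auxiliary is `V = (U₀, U₂)`.
  refine ⟨𝒰₀ × 𝒰₂, inferInstance, law P fun τ => ((τ.1.1, τ.1.2.2), τ.2), law_mem_stdSimplex hP _,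
    fun s => ?_, by rwa [law_law], ?_⟩
  · rw [law_law, ← hXu s]
    exact (congrFun hX0 s).symm
  rw [e1]
  -- Independence of `X₁` and `U₀` gives `I(V;X₁) = I(U₂;X₁|U₀)`. This is at most `I(U₁;U₂|U₀)`,
  -- since `X₁` is a function of `(U₀,U₁)`; `t5` and `t6` are this data-processing step. `t4` gives
  -- `I(U₂;Y₂|U₀) ≤ I(V;Y₂)`.
  have t1 := entropy_pair_bool_of_eq hp (fun ω => ω.1.1) (fun ω => ω.2.1.1) hu
  have t2 := entropy_pair_bool_of_mul_eq_zero p _ _ hd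
  have t3 := entropy_bool_eq_one hp.2 (fun ω => ω.2.1.1) (hXu true)
  have t4 := entropy_pair_le hp (fun ω => ω.2.2.2) (fun ω => ω.1.1)
  have t5 := entropy_submodular hp.1 (fun ω => ω.1.2.1) (fun ω => ω.1.2.2)
    (fun ω => (ω.1.1, ω.2.1.1))
  have t6 := entropy_le_entropy_pair hp.1 (fun ω => (ω.1.2.1, ω.1.2.2, ω.1.1)) (fun ω => ω.2.1.1)
  have u1 : entropy p (fun ω => ((ω.1.2.1, ω.1.2.2, ω.1.1), ω.2.1.1))
      = entropy p (fun ω => (ω.1.2.1, ω.1.2.2, ω.1.1, ω.2.1.1)) :=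
    entropy_eq_of_comp p (fun x => (x.1.1, x.1.2.1, x.1.2.2, x.2))
      (fun x => ((x.1, x.2.1, x.2.2.1), x.2.2.2)) (fun _ => rfl) (fun _ => rfl)
  have u2 : entropy p (fun ω => (ω.1.2.1, ω.1.1, ω.2.1.1))
      = entropy p (fun ω => ((ω.1.1, ω.1.2.1), ω.2.1.1)) :=
    entropy_eq_of_comp p (fun x => ((x.2.1, x.1), x.2.2)) (fun x => (x.1.2, x.1.1, x.2))
      (fun _ => rfl) (fun _ => rfl)
  have u3 : entropy p (fun ω => (ω.1.2.2, ω.1.1, ω.2.1.1))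
      = entropy p (fun ω => ((ω.1.1, ω.1.2.2), ω.2.1.1)) :=
    entropy_eq_of_comp p (fun x => ((x.2.1, x.1), x.2.2)) (fun x => (x.1.2, x.1.1, x.2))
      (fun _ => rfl) (fun _ => rfl)
  have u4 : entropy p (fun ω => (ω.1.2.2, ω.2.2.2, ω.1.1))
      = entropy p (fun ω => ((ω.1.1, ω.1.2.2), ω.2.2.2)) :=
    entropy_eq_of_comp p (fun x => ((x.2.2, x.1), x.2.1)) (fun x => (x.1.2, x.2, x.1.1))
      (fun _ => rfl) (fun _ => rfl)
  simp only [mutualInfo, condMutualInfo, entropy_law] at hC hI ⊢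
  linarith

/-- The crude bound on `R₂` serves only to make its supremum a supremum of a bounded set. -/
theorem le_of_mem_regionNS {A : Set (Bool × Bool → ℝ)} {r R₁ R₂ : ℝ}
    (h : (r, R₁, R₂) ∈ regionNS (semiOrthogonal K) A) : R₁ ≤ bscCapacity ∧ R₂ ≤ 1 + r := by
  obtain ⟨-, -, -, 𝒰₀, 𝒰₁, 𝒰₂, _, _, _, P, hP, hA, hR, hC, -⟩ := h
  have hp := jointLaw_mem_stdSimplex hP (semiOrthogonal K)
  refine ⟨hR.trans (mutualInfo_le_bscCapacity hP (fun τ => (τ.1.1, τ.1.2.1))), hC.trans ?_⟩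
  have h1 := mutualInfo_le_entropy hp.1 (fun ω => (ω.1.1, ω.1.2.2)) (fun ω => ω.2.2.2)
  have h2 := entropy_bool_le_one hp.2 (fun ω => ω.2.2.2)
  exact add_le_add_left (h1.trans h2) _

end SemiOrthogonal

/-! ### Entropy inequalities for the Gelfand-Pinsker bounds -/

theorem bconv_one_sub (ε t : ℝ) : bconv ε (1 - t) = 1 - bconv ε t := by unfold bconv; ring

theorem bconv_zero (ε : ℝ) : bconv ε 0 = ε := by unfold bconv; ring

@[fun_prop]
theorem continuous_bconv (ε : ℝ) : Continuous (bconv ε) := by unfold bconv; fun_prop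

theorem bconv_sub (ε s t : ℝ) : bconv ε s - bconv ε t = (1 - 2 * ε) * (s - t) := by
  unfold bconv; ring

/-- A strictly concave function lies strictly below its tangent away from the point of contact. -/
theorem binEntropy_lt_tangent {r u : ℝ} (hr : r ∈ Set.Ioo (0 : ℝ) 1) (hu : u ∈ Set.Icc (0 : ℝ) 1)
    (hne : u ≠ r) : Real.binEntropy u
      < Real.binEntropy r + (Real.log (1 - r) - Real.log r) * (u - r) := by
  have hd := Real.hasDerivAt_binEntropy hr.1.ne' hr.2.ne
  have hr' := Set.Ioo_subset_Icc_self hr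
  rcases hne.lt_or_gt with h | h
  · have := StrictConcaveOn.lt_slope_of_hasDerivAt Real.strictConcave_binEntropy hu hr' h hd
    rw [slope_def_field, lt_div_iff₀ (by linarith)] at this
    linarith
  · have := StrictConcaveOn.slope_lt_of_hasDerivAt Real.strictConcave_binEntropy hr' hu h hd
    rw [slope_def_field, div_lt_iff₀ (by linarith)] at this
    linarith

/-! ### The tangent bound for the dirty-paper channel -/

section Tangent

variable {ε q : ℝ}

/-- The tangent at `q` of `d ↦ h(ε ⋆ d) - h(ε)`. -/
noncomputable def csiTangent (ε q d : ℝ) : ℝ :=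
  Real.binEntropy (bconv ε q) - Real.binEntropy ε
    + (Real.log (1 - bconv ε q) - Real.log (bconv ε q)) * ((1 - 2 * ε) * (d - q))

theorem bconv_mem (hε : ε ∈ Set.Ioo (0 : ℝ) (1 / 2)) {t : ℝ} (ht : t ∈ Set.Icc (0 : ℝ) (1 / 2)) :
    ε ≤ bconv ε t ∧ t ≤ bconv ε t ∧ bconv ε t ≤ 1 / 2 := by
  obtain ⟨h1, h2⟩ := hε
  obtain ⟨h3, h4⟩ := ht
  unfold bconv
  refine ⟨?_, ?_, ?_⟩ <;> nlinarith

theorem bconv_mem_Ioo (hε : ε ∈ Set.Ioo (0 : ℝ) (1 / 2)) (hq : q ∈ Set.Ioo (0 : ℝ) (1 / 2)) :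
    ε < bconv ε q ∧ q < bconv ε q ∧ bconv ε q < 1 / 2 := by
  obtain ⟨h1, h2⟩ := hε
  obtain ⟨h3, h4⟩ := hq
  unfold bconv
  refine ⟨?_, ?_, ?_⟩ <;> nlinarith

theorem slope_csiTangent_pos (hε : ε ∈ Set.Ioo (0 : ℝ) (1 / 2)) (hq : q ∈ Set.Ioo (0 : ℝ) (1 / 2)) :
    0 < (Real.log (1 - bconv ε q) - Real.log (bconv ε q)) * (1 - 2 * ε) := by
  obtain ⟨h1, h2, h3⟩ := bconv_mem_Ioo hε hq
  refine mul_pos (sub_pos.2 (Real.log_lt_log (hε.1.trans h1) (by linarith))) ?_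
  linarith [hε.2]

theorem csiTangent_mono (hε : ε ∈ Set.Ioo (0 : ℝ) (1 / 2)) (hq : q ∈ Set.Ioo (0 : ℝ) (1 / 2)) :
    Monotone (csiTangent ε q) := by
  intro d d' h
  have := mul_le_mul_of_nonneg_left h (slope_csiTangent_pos hε hq).le
  unfold csiTangent
  linarith

theorem lt_csiTangent (hε : ε ∈ Set.Ioo (0 : ℝ) (1 / 2)) (hq : q ∈ Set.Ioo (0 : ℝ) (1 / 2)) {d : ℝ}
    (hd : d ∈ Set.Icc (0 : ℝ) (1 / 2)) (hne : d ≠ q) :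
    Real.binEntropy (bconv ε d) - Real.binEntropy ε < csiTangent ε q d := by
  obtain ⟨h1, h2, h3⟩ := bconv_mem_Ioo hε hq
  obtain ⟨h4, h5, h6⟩ := bconv_mem hε hd
  have h7 : (1 - 2 * ε) ≠ 0 := by linarith [hε.2]
  have := binEntropy_lt_tangent (r := bconv ε q) (u := bconv ε d)
    ⟨hε.1.trans h1, by linarith⟩ ⟨hε.1.le.trans h4, by linarith⟩ (fun h => by
      have h8 := bconv_sub ε d q
      rw [h, sub_self] at h8
      rcases mul_eq_zero.1 h8.symm with h | h
      · exact h7 h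
      · exact hne (by linarith))
  rw [bconv_sub] at this
  unfold csiTangent
  linarith

theorem csiTangent_self (ε q : ℝ) :
    csiTangent ε q q = Real.binEntropy (bconv ε q) - Real.binEntropy ε := by
  simp [csiTangent]

theorem csiTangent_pos (hε : ε ∈ Set.Ioo (0 : ℝ) (1 / 2)) (hq : q ∈ Set.Ioo (0 : ℝ) (1 / 2))
    {d : ℝ} (hd : d ∈ Set.Icc (0 : ℝ) (1 / 2)) : 0 < csiTangent ε q d := by
  rcases eq_or_ne d q with rfl | hne
  · obtain ⟨h1, h2, h3⟩ := bconv_mem_Ioo hε hq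
    rw [csiTangent_self]
    exact sub_pos.2 (binEntropy_lt_of_mem hε.1.le h1 (by linarith))
  · obtain ⟨h4, h5, h6⟩ := bconv_mem hε hd
    refine lt_of_le_of_lt ?_ (lt_csiTangent hε hq hd hne)
    exact sub_nonneg.2 (binEntropy_le_of_mem hε.1.le h4 (by linarith))

/-- For `s ≤ t` the left-hand side is nonpositive. Otherwise put `d = s - t`: the points `ε ⋆ t` and
`ε ⋆ d` are complementary mixtures of `ε ⋆ s` and `ε`, so concavity gives `h(ε ⋆ t) + h(ε ⋆ d) ≥ h(ε
⋆ s) + h(ε) ≥ h(s) + h(ε)`. It remains to compare `h(ε ⋆ d) - h(ε)` with its tangent. -/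
theorem binEntropy_sub_lt_csiTangent_of_le_half (hε : ε ∈ Set.Ioo (0 : ℝ) (1 / 2))
    (hq : q ∈ Set.Ioo (0 : ℝ) (1 / 2)) {s t : ℝ} (hs : s ∈ Set.Icc (0 : ℝ) (1 / 2))
    (ht : t ∈ Set.Icc (0 : ℝ) (1 / 2)) :
    Real.binEntropy s - Real.binEntropy (bconv ε t) < csiTangent ε q |s - t| := by
  have hhalf : (2⁻¹ : ℝ) = 1 / 2 := by norm_num
  rcases le_or_gt s t with hst | hst
  · refine lt_of_le_of_lt ?_ (csiTangent_pos hε hq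
      ⟨abs_nonneg _, by rw [abs_le]; constructor <;> linarith [hs.1, hs.2, ht.1, ht.2]⟩)
    obtain ⟨h4, h5, h6⟩ := bconv_mem hε ht
    exact sub_nonpos.2 (binEntropy_le_of_mem hs.1 (hst.trans h5) (by linarith [hs.2]))
  rw [abs_of_pos (sub_pos.2 hst)]
  have hs0 : 0 < s := ht.1.trans_lt hst
  have hd : s - t ∈ Set.Icc (0 : ℝ) (1 / 2) := ⟨by linarith, by linarith [hs.2, ht.1]⟩
  obtain ⟨h4, h5, h6⟩ := bconv_mem hε hs
  have hmem : bconv ε s ∈ Set.Icc (0 : ℝ) 1 := ⟨by linarith [hε.1], by linarith⟩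
  have hmem0 : ε ∈ Set.Icc (0 : ℝ) 1 := ⟨hε.1.le, by linarith [hε.2]⟩
  have hl : t / s + (s - t) / s = 1 := by field_simp; ring
  have hl1 : 0 ≤ t / s := div_nonneg ht.1 hs0.le
  have hl2 : 0 < (s - t) / s := div_pos (sub_pos.2 hst) hs0
  have e1 : (t / s) • bconv ε s + ((s - t) / s) • ε = bconv ε t := by
    simp only [smul_eq_mul, bconv]; field_simp; ring
  have e2 : ((s - t) / s) • bconv ε s + (t / s) • ε = bconv ε (s - t) := by
    simp only [smul_eq_mul, bconv]; field_simp; ring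
  have hmono : Real.binEntropy s ≤ Real.binEntropy (bconv ε s) :=
    binEntropy_le_of_mem hs.1 h5 (by linarith [hs.2])
  have c1 := Real.strictConcave_binEntropy.concaveOn.2 hmem hmem0 hl1 hl2.le hl
  have c2 := Real.strictConcave_binEntropy.concaveOn.2 hmem hmem0 hl2.le hl1
    (by rw [add_comm]; exact hl)
  rw [e1] at c1
  rw [e2] at c2
  simp only [smul_eq_mul] at c1 c2
  have hsum : t / s * Real.binEntropy (bconv ε s) + (s - t) / s * Real.binEntropy ε
      + ((s - t) / s * Real.binEntropy (bconv ε s) + t / s * Real.binEntropy ε)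
      = Real.binEntropy (bconv ε s) + Real.binEntropy ε := by
    linear_combination (Real.binEntropy (bconv ε s) + Real.binEntropy ε) * hl
  -- The tangent inequality is strict unless `d = q`. In that case strictness comes from `h(s) < h(ε
  -- ⋆ s)` if `t = 0`, and from strict concavity if `t > 0`.
  rcases eq_or_ne (s - t) q with h | h
  · rw [h, csiTangent_self, ← h]
    rcases ht.1.eq_or_lt with h0 | h0
    · subst h0
      rw [sub_zero] at h ⊢
      subst h
      obtain ⟨h1, h2, h3⟩ := bconv_mem_Ioo hε hq
      have := binEntropy_lt_of_mem hs.1 h2 (by linarith)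
      rw [bconv_zero]
      linarith
    · have c3 := Real.strictConcave_binEntropy.2 hmem hmem0
        (show bconv ε s ≠ ε by
          have := bconv_sub ε s 0
          rw [bconv_zero, sub_zero] at this
          have h9 : 0 < (1 - 2 * ε) * s := mul_pos (by linarith [hε.2]) hs0
          intro h; rw [h, sub_self] at this; linarith) (div_pos h0 hs0) hl2 hl
      rw [e1] at c3
      simp only [smul_eq_mul] at c3
      linarith
  · have := lt_csiTangent hε hq hd h
    linarith

/-- Reflecting `s` or `t` about `1/2` preserves both entropies. Folding both into `[0, 1/2]` does
not increase `|s - t|`, and the tangent is increasing. -/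
theorem binEntropy_sub_lt_csiTangent (hε : ε ∈ Set.Ioo (0 : ℝ) (1 / 2))
    (hq : q ∈ Set.Ioo (0 : ℝ) (1 / 2)) {s t : ℝ} (hs : s ∈ Set.Icc (0 : ℝ) 1)
    (ht : t ∈ Set.Icc (0 : ℝ) 1) :
    Real.binEntropy s - Real.binEntropy (bconv ε t) < csiTangent ε q |s - t| := by
  obtain ⟨hs0, hs1⟩ := hs
  obtain ⟨ht0, ht1⟩ := ht
  have key (s' t' : ℝ) (h1 : s' ∈ Set.Icc (0 : ℝ) (1 / 2)) (h2 : t' ∈ Set.Icc (0 : ℝ) (1 / 2))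
      (h3 : |s' - t'| ≤ |s - t|) (h4 : Real.binEntropy s' = Real.binEntropy s)
      (h5 : Real.binEntropy (bconv ε t') = Real.binEntropy (bconv ε t)) :
      Real.binEntropy s - Real.binEntropy (bconv ε t) < csiTangent ε q |s - t| := by
    rw [← h4, ← h5]
    exact (binEntropy_sub_lt_csiTangent_of_le_half hε hq h1 h2).trans_le (csiTangent_mono hε hq h3)
  have hc : Real.binEntropy (bconv ε (1 - t)) = Real.binEntropy (bconv ε t) := by
    rw [bconv_one_sub, Real.binEntropy_one_sub]
  have ha : |s - t| = max (s - t) (t - s) := by rw [abs_eq_max_neg, neg_sub]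
  rcases le_total s (1 / 2) with h | h <;> rcases le_total t (1 / 2) with h' | h'
  · exact key s t ⟨hs0, h⟩ ⟨ht0, h'⟩ le_rfl rfl rfl
  · refine key s (1 - t) ⟨hs0, h⟩ ⟨by linarith, by linarith⟩ ?_ rfl hc
    rw [ha, abs_le]
    have := le_max_right (s - t) (t - s)
    constructor <;> linarith
  · refine key (1 - s) t ⟨by linarith, by linarith⟩ ⟨ht0, h'⟩ ?_ (Real.binEntropy_one_sub s) rfl
    rw [ha, abs_le]
    have := le_max_left (s - t) (t - s)
    constructor <;> linarith
  · refine key (1 - s) (1 - t) ⟨by linarith, by linarith⟩ ⟨by linarith, by linarith⟩ ?_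
      (Real.binEntropy_one_sub s) hc
    rw [sub_sub_sub_cancel_left, abs_sub_comm]

/-- The strict inequality holds on a compact square, so the tangent can be lowered by the minimal
slack `δ > 0` and still dominate. Its value at `q` is then strictly below `h(ε ⋆ q) - h(ε)`. -/
theorem exists_linear_bound (hε : ε ∈ Set.Ioo (0 : ℝ) (1 / 2)) (hq : q ∈ Set.Ioo (0 : ℝ) (1 / 2)) :
    ∃ a b : ℝ, 0 ≤ b ∧ a + b * q < Real.binEntropy (bconv ε q) - Real.binEntropy ε ∧
      ∀ s ∈ Set.Icc (0 : ℝ) 1, ∀ t ∈ Set.Icc (0 : ℝ) 1,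
        Real.binEntropy s - Real.binEntropy (bconv ε t) ≤ a + b * |s - t| := by
  have hcont : Continuous fun x : ℝ × ℝ =>
      csiTangent ε q |x.1 - x.2| - (Real.binEntropy x.1 - Real.binEntropy (bconv ε x.2)) := by
    unfold csiTangent
    fun_prop
  obtain ⟨x, hx, hmin⟩ := (isCompact_Icc.prod isCompact_Icc :
    IsCompact (Set.Icc (0 : ℝ) 1 ×ˢ Set.Icc (0 : ℝ) 1)).exists_isMinOn
    ⟨(0, 0), by simp⟩ hcont.continuousOn
  have hpos := sub_pos.2 (binEntropy_sub_lt_csiTangent hε hq hx.1 hx.2)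
  set δ := csiTangent ε q |x.1 - x.2| - (Real.binEntropy x.1 - Real.binEntropy (bconv ε x.2))
  refine ⟨csiTangent ε q 0 - δ, (Real.log (1 - bconv ε q) - Real.log (bconv ε q)) * (1 - 2 * ε),
    (slope_csiTangent_pos hε hq).le, ?_, fun s hs t ht => ?_⟩
  · rw [← csiTangent_self]
    unfold csiTangent
    linarith
  · have : δ ≤ csiTangent ε q |s - t| - (Real.binEntropy s - Real.binEntropy (bconv ε t)) :=
      hmin (show (s, t) ∈ _ from ⟨hs, ht⟩)
    have h2 : csiTangent ε q |s - t| = csiTangent ε q 0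
        + (Real.log (1 - bconv ε q) - Real.log (bconv ε q)) * (1 - 2 * ε) * |s - t| := by
      unfold csiTangent
      ring
    linarith

end Tangent

theorem exists_binEntropy_sub_half_le : ∃ a : ℝ, a < Real.log 2 / 2 ∧
    ∀ s ∈ Set.Icc (0 : ℝ) 1, Real.binEntropy s - Real.binEntropy (s / 2) ≤ a := by
  have hcont : Continuous fun s : ℝ => Real.binEntropy s - Real.binEntropy (s / 2) := by fun_prop
  obtain ⟨x, hx, hmax⟩ := (isCompact_Icc : IsCompact (Set.Icc (0 : ℝ) 1)).exists_isMaxOn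
    ⟨0, by simp⟩ hcont.continuousOn
  refine ⟨_, ?_, fun s hs => hmax hs⟩
  have hl : 0 < Real.log 2 := Real.log_pos one_lt_two
  rcases hx.1.eq_or_lt with h | h
  · rw [← h]
    simpa using hl
  · have h1 := Real.strictConcave_binEntropy.2 hx (Set.left_mem_Icc.2 zero_le_one) h.ne'
      (one_half_pos (α := ℝ)) one_half_pos (add_halves 1)
    have h2 : (1 / 2 : ℝ) • x + (1 / 2 : ℝ) • (0 : ℝ) = x / 2 := by
      simp only [smul_eq_mul]; ring
    rw [h2] at h1
    simp only [smul_eq_mul, Real.binEntropy_zero] at h1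
    have h3 := Real.binEntropy_le_log_two (p := x)
    linarith

/-! ### Homogeneous forms -/

/-- The affine bound multiplied by the mass `s₀ + s₁` of a value of `V`; in this form it can be
summed over `V`, null values included. -/
theorem pairEntropy_sub_bsc_le {ε a b : ℝ} (hε : ε ∈ Set.Icc (0 : ℝ) (1 / 2)) (hb : 0 ≤ b)
    (hab : ∀ s ∈ Set.Icc (0 : ℝ) 1, ∀ t ∈ Set.Icc (0 : ℝ) 1,
      Real.binEntropy s - Real.binEntropy (bconv ε t) ≤ a + b * |s - t|)
    {s₀ s₁ t₀ t₁ d : ℝ} (hs₀ : 0 ≤ s₀) (hs₁ : 0 ≤ s₁) (ht₀ : 0 ≤ t₀) (ht₁ : 0 ≤ t₁)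
    (hsum : t₀ + t₁ = s₀ + s₁) (hd : |s₁ - t₁| ≤ d) :
    pairEntropy s₀ s₁ - pairEntropy ((1 - ε) * t₀ + ε * t₁) (ε * t₀ + (1 - ε) * t₁)
      ≤ a * (s₀ + s₁) + b * d := by
  obtain ⟨h1, h2⟩ := hε
  have h3 : 0 ≤ 1 - ε := by linarith
  rcases (add_nonneg hs₀ hs₁).eq_or_lt with h | h
  · have : s₀ = 0 := by linarith
    have : s₁ = 0 := by linarith
    have : t₀ = 0 := by linarith
    have : t₁ = 0 := by linarith
    subst_vars
    simpa [pairEntropy_zero_zero] using mul_nonneg hb ((abs_nonneg _).trans hd)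
  · have hm : (1 - ε) * t₀ + ε * t₁ + (ε * t₀ + (1 - ε) * t₁) = s₀ + s₁ := by
      rw [← hsum]; ring
    rw [pairEntropy_eq hs₀ hs₁ h, pairEntropy_eq (by positivity) (by positivity) (by rwa [hm]), hm]
    have hbc : (ε * t₀ + (1 - ε) * t₁) / (s₀ + s₁) = bconv ε (t₁ / (s₀ + s₁)) := by
      have : t₀ = s₀ + s₁ - t₁ := by linarith
      unfold bconv
      rw [this]
      field_simp
      ring
    have hst := hab (s₁ / (s₀ + s₁)) ⟨by positivity, by rw [div_le_one h]; linarith⟩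
      (t₁ / (s₀ + s₁)) ⟨by positivity, by rw [div_le_one h]; linarith⟩
    rw [← sub_div, abs_div, abs_of_pos h] at hst
    rw [hbc, ← mul_sub]
    calc _ ≤ (s₀ + s₁) * (a + b * (|s₁ - t₁| / (s₀ + s₁))) :=
          mul_le_mul_of_nonneg_left hst h.le
      _ = a * (s₀ + s₁) + b * |s₁ - t₁| := by field_simp
      _ ≤ _ := by gcongr

/-- Here `s` is the mass of `X₁ = 1`, and `x₀`, `x₁` are the masses of the two inputs with `X₁ = 0`.
The coin gives each output mass at least `s/2`, so the output entropy is at least that of the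
parameter `s/2` (after normalisation). -/
theorem pairEntropy_sub_coin_le {a : ℝ}
    (ha : ∀ s ∈ Set.Icc (0 : ℝ) 1, Real.binEntropy s - Real.binEntropy (s / 2) ≤ a)
    {x₀ x₁ s : ℝ} (hx₀ : 0 ≤ x₀) (hx₁ : 0 ≤ x₁) (hs : 0 ≤ s) :
    pairEntropy (x₀ + x₁) s - pairEntropy (x₀ + s / 2) (x₁ + s / 2) ≤ a * (x₀ + x₁ + s) := by
  have h0 : 0 ≤ x₀ + x₁ + s := by positivity
  rcases h0.eq_or_lt with h | h
  · have : x₀ = 0 := by linarith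
    have : x₁ = 0 := by linarith
    have : s = 0 := by linarith
    subst_vars
    simp [pairEntropy_zero_zero]
  · have hm : x₀ + s / 2 + (x₁ + s / 2) = x₀ + x₁ + s := by ring
    rw [pairEntropy_eq (by positivity) hs h, pairEntropy_eq (by positivity) (by positivity)
      (by rwa [hm]), hm, ← mul_sub, mul_comm a]
    refine mul_le_mul_of_nonneg_left ?_ h.le
    have h1 := ha (s / (x₀ + x₁ + s)) ⟨by positivity, by rw [div_le_one h]; linarith⟩
    have h2 : Real.binEntropy (s / (x₀ + x₁ + s) / 2)
        ≤ Real.binEntropy ((x₁ + s / 2) / (x₀ + x₁ + s)) := by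
      refine binEntropy_le_of_mem (by positivity) ?_ ?_
      · rw [div_right_comm]
        gcongr
        linarith
      · rw [div_right_comm, div_le_iff₀ h, sub_mul, div_mul_cancel₀ _ h.ne']
        linarith
    linarith

/-! ### Capacities -/

section Capacities

variable {T α : Type*} [Fintype T]

theorem law_pair_fst (P : T × (Bool × Bool) → ℝ) (g : Bool × Bool → α) (v : T) (a : α) :
    law P (fun τ => (τ.1, g τ.2)) (v, a) = law (fun x => P (v, x)) g a := by
  classical
  simp only [law_eq_sum_ite]
  rw [Fintype.sum_prod_type, Finset.sum_eq_single v (fun w _ hw => by simp [hw]) (by simp)]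
  simp

/-- A state law with `X₂ ∼ Ber(q)` independent of `X₁`, and with `V = X₂`. -/
noncomputable def productLaw (q : ℝ) : Bool × (Bool × Bool) → ℝ :=
  fun τ => if τ.1 = τ.2.2 then (if τ.1 then q else 1 - q) / 2 else 0

theorem isStateLaw_productLaw {q : ℝ} (hq : q ∈ Set.Icc (0 : ℝ) (1 / 2)) :
    IsStateLaw q (productLaw q) := by
  classical
  obtain ⟨h0, h1⟩ := hq
  refine ⟨⟨fun τ => ?_, ?_⟩, fun s => ?_, ?_⟩
  · unfold productLaw
    split_ifs <;> linarith
  · simp [productLaw, Fintype.sum_prod_type]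
  · cases s <;> simp [law_eq_sum_ite, productLaw, Fintype.sum_prod_type] <;> ring
  · simp only [weightConstraint, Set.mem_ofPred_eq, law_law]
    simp [law_eq_sum_ite, productLaw, Fintype.sum_prod_type]

theorem law_xor {Ω : Type*} [Fintype Ω] (p : Ω → ℝ) (f g : Ω → Bool) (c : Bool) :
    law p (fun ω => xor (f ω) (g ω)) c = law p (fun ω => (f ω, g ω)) (false, c)
      + law p (fun ω => (f ω, g ω)) (true, !c) := by
  classical
  simp only [law_eq_sum_ite, ← Finset.sum_add_distrib]
  refine Finset.sum_congr rfl fun ω _ => ?_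
  cases f ω <;> cases g ω <;> cases c <;> simp

theorem isBSCOutput_dirtyPaper {ε : ℝ} (hε : ε ∈ Set.Icc (0 : ℝ) (1 / 2))
    (P : T × (Bool × Bool) → ℝ) (f : T × (Bool × Bool) → α) :
    IsBSCOutput ε (jointLaw P (dirtyPaper ε hε)) (fun ω => f (ω.1, ω.2.1))
      (fun ω => xor ω.2.1.2 ω.2.1.1) (fun ω => ω.2.2) :=
  isBSCOutput_jointLaw hε P (dirtyPaper ε hε) f (fun x => xor x.2 x.1) (fun y => y)
    fun _ => law_id _

/-- Given `X₁`, the output is equivalent to `X₁ ⊕ Y₂ = X₂ ⊕ Z`, whose unconditional entropy is at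
most that of `ε ⋆ q` because `q ≤ 1/2`. Given also `V`, at least the noise entropy remains. -/
theorem condMutualInfo_dirtyPaper_le {ε q : ℝ} (hε : ε ∈ Set.Icc (0 : ℝ) (1 / 2))
    (hq : q ∈ Set.Icc (0 : ℝ) (1 / 2)) {𝒱 : Type} [Fintype 𝒱] {P : 𝒱 × (Bool × Bool) → ℝ}
    (hP : IsStateLaw q P) :
    condMutualInfo (jointLaw P (dirtyPaper ε hε)) (fun ω => ω.1) (fun ω => ω.2.2)
      (fun ω => ω.2.1.1) ≤ (Real.binEntropy (bconv ε q) - Real.binEntropy ε) / Real.log 2 := by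
  have hl : 0 < Real.log 2 := Real.log_pos one_lt_two
  have hp := jointLaw_mem_stdSimplex hP.1 (dirtyPaper ε hε)
  have h1 := (isBSCOutput_dirtyPaper hε P (fun τ => (τ.1, τ.2.1))).entropy_add_le hε hp
  have h2 := isBSCOutput_dirtyPaper hε P (fun τ => τ.2.1)
  have hX2 := congrFun (law_jointLaw P (dirtyPaper ε hε) (fun τ => τ.2.2))
  set p := jointLaw P (dirtyPaper ε hε)
  have hX2' : law p (fun ω => ω.2.1.2) true ≤ q := by
    have := hP.2.2
    simp only [weightConstraint, Set.mem_ofPred_eq, law_law] at this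
    exact (hX2 true).trans_le this
  have hx0 := law_nonneg hp.1 (fun ω => ω.2.1.2) true
  have e1 : entropy p (fun ω => (ω.2.2, ω.2.1.1))
      = entropy p (fun ω => (xor ω.2.1.1 ω.2.2, ω.2.1.1)) :=
    entropy_eq_of_comp p (fun x => (xor x.2 x.1, x.2)) (fun x => (xor x.2 x.1, x.2))
      (fun _ => rfl) (fun _ => by simp)
  have e2 : entropy p (fun ω => ((ω.1, ω.2.1.1), ω.2.2))
      = entropy p (fun ω => (ω.1, ω.2.2, ω.2.1.1)) :=
    entropy_eq_of_comp p (fun x => (x.1.1, x.2, x.1.2)) (fun x => ((x.1, x.2.2), x.2.1))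
      (fun _ => rfl) (fun _ => rfl)
  have h3 := entropy_pair_le hp (fun ω => xor ω.2.1.1 ω.2.2) (fun ω => ω.2.1.1)
  have e3 : law p (fun ω => xor ω.2.1.1 ω.2.2) true
      = bconv ε (law p (fun ω => ω.2.1.2) true) := by
    have hxx : (fun ω : 𝒱 × (Bool × Bool) × Bool => ω.2.1.2)
        = fun ω => xor ω.2.1.1 (xor ω.2.1.2 ω.2.1.1) := by
      funext ω
      cases ω.2.1.1 <;> simp
    have h4 := law_bool_add hp.2 (fun ω => ω.2.1.2)
    have h5 (c) := law_xor p (fun ω => ω.2.1.1) (fun ω => xor ω.2.1.2 ω.2.1.1) c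
    rw [← hxx] at h5
    have hb : bconv ε (law p (fun ω => ω.2.1.2) true)
      = (1 - ε) * law p (fun ω => ω.2.1.2) true + ε * law p (fun ω => ω.2.1.2) false := by
      unfold bconv; rw [← h4]; ring
    rw [law_xor, h2, h2, hb, h5, h5]
    simp only [Bool.not_true, Bool.not_false]
    ring
  have h6 : entropy p (fun ω => xor ω.2.1.1 ω.2.2) ≤ Real.binEntropy (bconv ε q) / Real.log 2 := by
    rw [le_div_iff₀ hl, entropy_bool hp.2, e3]
    have hm : (1 - 2 * ε) * law p (fun ω => ω.2.1.2) true ≤ (1 - 2 * ε) * q :=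
      mul_le_mul_of_nonneg_left hX2' (by linarith [hε.2])
    have hm2 : (1 - 2 * ε) * q ≤ (1 - 2 * ε) * (1 / 2) :=
      mul_le_mul_of_nonneg_left hq.2 (by linarith [hε.2])
    have hm3 : 0 ≤ (1 - 2 * ε) * law p (fun ω => ω.2.1.2) true :=
      mul_nonneg (by linarith [hε.2]) hx0
    have hε0 := hε.1
    refine binEntropy_le_of_mem ?_ ?_ ?_ <;> unfold bconv <;> linarith
  unfold condMutualInfo
  rw [sub_div]
  linarith

theorem condMutualInfo_productLaw {ε q : ℝ} (hε : ε ∈ Set.Icc (0 : ℝ) (1 / 2))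
    (hq : q ∈ Set.Icc (0 : ℝ) (1 / 2)) :
    condMutualInfo (jointLaw (productLaw q) (dirtyPaper ε hε)) (fun ω => ω.1) (fun ω => ω.2.2)
      (fun ω => ω.2.1.1) = (Real.binEntropy (bconv ε q) - Real.binEntropy ε) / Real.log 2 := by
  classical
  have hl : 0 < Real.log 2 := Real.log_pos one_lt_two
  obtain ⟨hP, hX, -⟩ := isStateLaw_productLaw hq
  have hp := jointLaw_mem_stdSimplex hP (dirtyPaper ε hε)
  have h1 := (isBSCOutput_dirtyPaper hε (productLaw q) (fun τ => (τ.1, τ.2.1))).entropy_eq hε hp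
    (fun a => by
      have := congrFun (law_jointLaw (productLaw q) (dirtyPaper ε hε)
        (fun τ => ((τ.1, τ.2.1), xor τ.2.2 τ.2.1)))
      rw [this, this]
      rcases a with ⟨- | -, - | -⟩ <;> simp [law_eq_sum_ite, productLaw, Fintype.sum_prod_type])
  have h2 := isBSCOutput_dirtyPaper hε (productLaw q) (fun τ => τ.2.1)
  have h3 := congrFun (law_jointLaw (productLaw q) (dirtyPaper ε hε)
        (fun τ => (τ.2.1, xor τ.2.2 τ.2.1)))
  have h4 (x z : Bool) : law (productLaw q) (fun τ => (τ.2.1, xor τ.2.2 τ.2.1)) (x, z)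
      = (if xor x z then q else 1 - q) / 2 := by
    cases x <;> cases z <;> simp [law_eq_sum_ite, productLaw, Fintype.sum_prod_type]
  have hX1 := congrFun (law_jointLaw (productLaw q) (dirtyPaper ε hε) (fun τ => τ.2.1))
  set p := jointLaw (productLaw q) (dirtyPaper ε hε)
  have e1 : entropy p (fun ω => (ω.2.2, ω.2.1.1))
      = entropy p (fun ω => (xor ω.2.1.1 ω.2.2, ω.2.1.1)) :=
    entropy_eq_of_comp p (fun x => (xor x.2 x.1, x.2)) (fun x => (xor x.2 x.1, x.2))
      (fun _ => rfl) (fun _ => by simp)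
  have e2 : entropy p (fun ω => ((ω.1, ω.2.1.1), ω.2.2))
      = entropy p (fun ω => (ω.1, ω.2.2, ω.2.1.1)) :=
    entropy_eq_of_comp p (fun x => (x.1.1, x.2, x.1.2)) (fun x => ((x.1, x.2.2), x.2.1))
      (fun _ => rfl) (fun _ => rfl)
  have e3 (x z : Bool) : law p (fun ω => (ω.2.1.1, ω.2.2)) (x, z)
      = (if xor x z then bconv ε q else 1 - bconv ε q) / 2 := by
    rw [h2, h3, h3, h4, h4]
    unfold bconv
    cases x <;> cases z <;> simp <;> ring
  have e4 (w x : Bool) : law p (fun ω => (xor ω.2.1.1 ω.2.2, ω.2.1.1)) (w, x)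
      = (if w then bconv ε q else 1 - bconv ε q) / 2 := by
    have := law_comp_injective p (fun ω => (ω.2.1.1, ω.2.2)) (e := fun x => (xor x.1 x.2, x.1))
      (by decide) (x, xor x w)
    simp only [Bool.bne_self_left] at this
    rw [e3] at this
    simpa using this
  -- For the product law `X₁ ⊕ Y₂` is independent of the uniform state, so the bound `H(X₁ ⊕ Y₂|X₁)
  -- ≤ H(X₁ ⊕ Y₂)` is an equality.
  have h5 := entropy_pair_bool_of_eq hp (fun ω => xor ω.2.1.1 ω.2.2) (fun ω => ω.2.1.1)
    (fun a => by rw [e4, e4])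
  have h6 : entropy p (fun ω => ω.2.1.1) = 1 :=
    entropy_bool_eq_one hp.2 _ ((hX1 true).trans (hX true))
  have h7 : entropy p (fun ω => xor ω.2.1.1 ω.2.2) = Real.binEntropy (bconv ε q) / Real.log 2 := by
    rw [eq_div_iff hl.ne', entropy_bool hp.2, law_xor, e3, e3]
    congr 1
    simp
  unfold condMutualInfo
  rw [sub_div]
  linarith

theorem fullCSICapacity_dirtyPaper {ε q : ℝ} (hε : ε ∈ Set.Icc (0 : ℝ) (1 / 2))
    (hq : q ∈ Set.Icc (0 : ℝ) (1 / 2)) :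
    fullCSICapacity (dirtyPaper ε hε) q
      = (Real.binEntropy (bconv ε q) - Real.binEntropy ε) / Real.log 2 := by
  refine IsGreatest.csSup_eq ⟨⟨Bool, inferInstance, productLaw q, isStateLaw_productLaw hq,
    (condMutualInfo_productLaw hε hq).symm⟩, ?_⟩
  rintro r ⟨𝒱, _, P, hP, rfl⟩
  exact condMutualInfo_dirtyPaper_le hε hq hP

/-- The rate equals `H(Y₂) - H(X₁) + H(X₁|V) - H(Y₂|V)`, and `H(Y₂) ≤ 1 = H(X₁)`. What remains is a
sum over `v`, so it can be bounded one value at a time. -/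
theorem gelfandPinsker_mul_log_two_le {𝒱 : Type} [Fintype 𝒱] (K : Channel (Bool × Bool) Bool)
    {P : 𝒱 × (Bool × Bool) → ℝ} (hP : P ∈ stdSimplex ℝ (𝒱 × (Bool × Bool)))
    (hX : ∀ s, law P (fun τ => τ.2.1) s = 1 / 2) :
    (mutualInfo (jointLaw P K) (fun ω => ω.1) (fun ω => ω.2.2)
        - mutualInfo (jointLaw P K) (fun ω => ω.1) (fun ω => ω.2.1.1)) * Real.log 2
      ≤ ∑ v, (pairEntropy (law (fun x => P (v, x)) Prod.fst false)
            (law (fun x => P (v, x)) Prod.fst true)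
          - pairEntropy (law (jointLaw P K) (fun ω => (ω.1, ω.2.2)) (v, false))
            (law (jointLaw P K) (fun ω => (ω.1, ω.2.2)) (v, true))) := by
  have hl : 0 < Real.log 2 := Real.log_pos one_lt_two
  have hp := jointLaw_mem_stdSimplex hP K
  have hX1 := congrFun (law_jointLaw P K (fun τ => τ.2.1))
  have hVX := congrFun (law_jointLaw P K (fun τ => (τ.1, τ.2.1)))
  have h1 := entropy_bool_le_one hp.2 (fun ω => ω.2.2)
  have h2 : entropy (jointLaw P K) (fun ω => ω.2.1.1) = 1 :=
    entropy_bool_eq_one hp.2 _ ((hX1 true).trans (hX true))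
  have h3 := entropy_pair_bool (jointLaw P K) (fun ω => ω.1) (fun ω => ω.2.1.1)
  have h4 := entropy_pair_bool (jointLaw P K) (fun ω => ω.1) (fun ω => ω.2.2)
  simp only [hVX, law_pair_fst P Prod.fst] at h3
  rw [Finset.sum_sub_distrib]
  have h5 := mul_le_mul_of_nonneg_right h1 hl.le
  unfold mutualInfo
  rw [h2]
  linarith

/-- Makes the set defining `gelfandPinskerCapacity` bounded above; the supremum of an unbounded set
of reals would be the default value `0`. -/
theorem gelfandPinsker_le_one {𝒱 : Type} [Fintype 𝒱] (K : Channel (Bool × Bool) Bool)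
    {P : 𝒱 × (Bool × Bool) → ℝ} (hP : P ∈ stdSimplex ℝ (𝒱 × (Bool × Bool))) :
    mutualInfo (jointLaw P K) (fun ω => ω.1) (fun ω => ω.2.2)
        - mutualInfo (jointLaw P K) (fun ω => ω.1) (fun ω => ω.2.1.1) ≤ 1 := by
  have hp := jointLaw_mem_stdSimplex hP K
  have h1 := entropy_bool_le_one hp.2 (fun ω => ω.2.2)
  have h2 := mutualInfo_le_entropy hp.1 (fun ω => ω.1) (fun ω => ω.2.2)
  have h3 := mutualInfo_nonneg hp (fun ω => ω.1) (fun ω => ω.2.1.1)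
  linarith

theorem gelfandPinsker_le_capacity {𝒱 : Type} [Fintype 𝒱] (K : Channel (Bool × Bool) Bool)
    {q : ℝ} {P : 𝒱 × (Bool × Bool) → ℝ} (hP : IsStateLaw q P) :
    mutualInfo (jointLaw P K) (fun ω => ω.1) (fun ω => ω.2.2)
        - mutualInfo (jointLaw P K) (fun ω => ω.1) (fun ω => ω.2.1.1)
      ≤ gelfandPinskerCapacity K q := by
  refine le_csSup ⟨1, ?_⟩ ⟨𝒱, _, P, hP, rfl⟩
  rintro r ⟨𝒱, _, P, hP, rfl⟩
  exact gelfandPinsker_le_one K hP.1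

theorem gelfandPinskerCapacity_lt_fullCSICapacity {ε q : ℝ} (hε : ε ∈ Set.Ioo (0 : ℝ) (1 / 2))
    (hq : q ∈ Set.Ioo (0 : ℝ) (1 / 2)) :
    gelfandPinskerCapacity (dirtyPaper ε (Set.Ioo_subset_Icc_self hε)) q
      < fullCSICapacity (dirtyPaper ε (Set.Ioo_subset_Icc_self hε)) q := by
  classical
  have hl : 0 < Real.log 2 := Real.log_pos one_lt_two
  have hε' := Set.Ioo_subset_Icc_self hε
  have hq' := Set.Ioo_subset_Icc_self hq
  obtain ⟨a, b, hb, hlt, hab⟩ := exists_linear_bound hε hq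
  rw [fullCSICapacity_dirtyPaper _ hq']
  refine lt_of_le_of_lt (csSup_le ⟨_, Bool, inferInstance, productLaw q,
    isStateLaw_productLaw hq', rfl⟩ ?_) (div_lt_div_of_pos_right hlt hl)
  rintro r ⟨𝒱, _, P, hP, rfl⟩
  rw [le_div_iff₀ hl]
  refine (gelfandPinsker_mul_log_two_le _ hP.1 hP.2.1).trans ?_
  have h0 := hP.1.1
  calc _ ≤ ∑ v, (a * law P (fun τ => τ.1) v + b * law P (fun τ => (τ.1, τ.2.2)) (v, true)) := by
        refine Finset.sum_le_sum fun v _ => ?_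
        have hY (z : Bool) := isBSCOutput_dirtyPaper hε' P (fun τ => τ.1) v z
        have hT (z : Bool) := (congrFun (law_jointLaw P (dirtyPaper ε hε')
          (fun τ => (τ.1, xor τ.2.2 τ.2.1))) (v, z)).trans
            (law_pair_fst P (fun x => xor x.2 x.1) v z)
        rw [hY, hY, Bool.not_false, Bool.not_true, hT, hT, law_pair_fst P Prod.snd,
          ← law_pair_bool_add P (fun τ => τ.1) (fun τ => τ.2.1) v, law_pair_fst P Prod.fst,
          law_pair_fst P Prod.fst, add_comm ((1 - ε) * law _ _ true)]
        refine pairEntropy_sub_bsc_le hε' hb hab (law_nonneg (fun x => h0 _) _ _)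
          (law_nonneg (fun x => h0 _) _ _) (law_nonneg (fun x => h0 _) _ _)
          (law_nonneg (fun x => h0 _) _ _) ?_ ?_
        · simp [law_eq_sum_ite, Fintype.sum_prod_type]
          ring
        -- The masses of `X₁ = 1` and `X₁ ⊕ X₂ = 1` differ by `P(v,(1,1)) - P(v,(0,1))`, which is at
        -- most the mass of `X₂ = 1` in absolute value.
        · have h1 := h0 (v, (true, true))
          have h2 := h0 (v, (false, true))
          simp [law_eq_sum_ite, Fintype.sum_prod_type]
          rw [abs_le]
          constructor <;> linarith
    _ = a + b * law P (fun τ => τ.2.2) true := by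
        rw [Finset.sum_add_distrib, ← Finset.mul_sum, ← Finset.mul_sum, sum_law, hP.1.2, mul_one,
          sum_law_pair_left P (fun τ => τ.1) (fun τ => τ.2.2) true]
    _ ≤ a + b * q := by
        have := hP.2.2
        simp only [weightConstraint, Set.mem_ofPred_eq, law_law] at this
        gcongr

end Capacities

/-! ### A channel without input constraint -/

section CoinChannel

/-- The channel that transmits `X₂` noiselessly if `X₁ = 0`, and outputs a fair coin if `X₁ = 1`. -/
noncomputable def coinChannel : Channel (Bool × Bool) Bool where
  prob x y := if x.1 then 1 / 2 else if y = x.2 then 1 else 0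
  mem_stdSimplex x := by
    refine ⟨fun y => ?_, ?_⟩
    · dsimp only
      split_ifs <;> norm_num
    · rcases x with ⟨- | -, - | -⟩ <;> norm_num

theorem exists_gelfandPinsker_coinChannel_le : ∃ a : ℝ, a < 1 / 2 ∧
    ∀ (𝒱 : Type) (_ : Fintype 𝒱) (P : 𝒱 × (Bool × Bool) → ℝ),
      P ∈ stdSimplex ℝ (𝒱 × (Bool × Bool)) → (∀ s, law P (fun τ => τ.2.1) s = 1 / 2) →
      mutualInfo (jointLaw P coinChannel) (fun ω => ω.1) (fun ω => ω.2.2)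
        - mutualInfo (jointLaw P coinChannel) (fun ω => ω.1) (fun ω => ω.2.1.1) ≤ a := by
  classical
  have hl : 0 < Real.log 2 := Real.log_pos one_lt_two
  obtain ⟨a, hlt, ha⟩ := exists_binEntropy_sub_half_le
  refine ⟨a / Real.log 2, by rw [div_lt_iff₀ hl]; linarith, fun 𝒱 _ P hP hX => ?_⟩
  rw [le_div_iff₀ hl]
  refine (gelfandPinsker_mul_log_two_le _ hP hX).trans ?_
  have h0 := hP.1
  calc _ ≤ ∑ v, a * law P (fun τ => τ.1) v := by
        refine Finset.sum_le_sum fun v _ => ?_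
        have hY (z : Bool) := (law_jointLaw_pair P coinChannel (fun τ => τ.1) (fun y => y) v z)
        have hY' (z : Bool) : law (fun τ => P τ * law (coinChannel.prob τ.2) (fun y => y) z)
            (fun τ => τ.1) v = P (v, (false, z)) + (P (v, (true, false)) + P (v, (true, true))) / 2 := by
          simp only [law_id]
          rw [law_eq_sum_ite, Fintype.sum_prod_type,
            Finset.sum_eq_single v (fun w _ hw => by simp [hw]) (by simp)]
          cases z <;> simp [coinChannel, Fintype.sum_prod_type] <;> ring
        have h1 (s : Bool) : law (fun x => P (v, x)) Prod.fst s
            = P (v, (s, false)) + P (v, (s, true)) := by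
          cases s <;> simp [law_eq_sum_ite, Fintype.sum_prod_type, add_comm]
        rw [hY, hY, hY', hY', ← law_pair_bool_add P (fun τ => τ.1) (fun τ => τ.2.1) v,
          law_pair_fst P Prod.fst, law_pair_fst P Prod.fst, h1, h1]
        exact pairEntropy_sub_coin_le ha (h0 _) (h0 _) (add_nonneg (h0 _) (h0 _))
    _ = a := by rw [← Finset.mul_sum, sum_law, hP.2, mul_one]

theorem condMutualInfo_coinChannel :
    condMutualInfo (jointLaw (productLaw (1 / 2)) coinChannel) (fun ω => ω.1) (fun ω => ω.2.2)
      (fun ω => ω.2.1.1) = 1 / 2 := by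
  classical
  have hl : 0 < Real.log 2 := Real.log_pos one_lt_two
  obtain ⟨hP, hX, -⟩ := isStateLaw_productLaw (q := 1 / 2) (by norm_num)
  have hp := jointLaw_mem_stdSimplex hP coinChannel
  have hX1 := congrFun (law_jointLaw (productLaw (1 / 2)) coinChannel (fun τ => τ.2.1))
  have h1 (a z) := law_jointLaw_pair (productLaw (1 / 2)) coinChannel
    (fun τ => (τ.1, τ.2.1)) (fun y => y) a z
  have h2 (a z) := law_jointLaw_pair (productLaw (1 / 2)) coinChannel
    (fun τ => τ.2.1) (fun y => y) a z
  simp only [law_id] at h1 h2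
  set p := jointLaw (productLaw (1 / 2)) coinChannel
  have e1 : entropy p (fun ω => (ω.2.2, ω.2.1.1)) = entropy p (fun ω => (ω.2.1.1, ω.2.2)) :=
    entropy_swap p _ _
  have e2 : entropy p (fun ω => (ω.1, ω.2.2, ω.2.1.1))
      = entropy p (fun ω => ((ω.1, ω.2.1.1), ω.2.2)) :=
    entropy_eq_of_comp p (fun x => ((x.1, x.2.2), x.2.1)) (fun x => (x.1.1, x.2, x.1.2))
      (fun _ => rfl) (fun _ => rfl)
  have h3 := entropy_pair_bool_of_eq hp (fun ω => ω.2.1.1) (fun ω => ω.2.2) (fun a => by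
    rw [h2, h2]
    cases a <;> simp [law_eq_sum_ite, productLaw, coinChannel, Fintype.sum_prod_type]; norm_num)
  have h4 := entropy_pair_bool p (fun ω => (ω.1, ω.2.1.1)) (fun ω => ω.2.2)
  have h5 : ∑ a : Bool × Bool, pairEntropy (law p (fun ω => ((ω.1, ω.2.1.1), ω.2.2)) (a, false))
      (law p (fun ω => ((ω.1, ω.2.1.1), ω.2.2)) (a, true)) = Real.log 2 / 2 := by
    -- For each `v`, the pair `(v, X₁ = 1)` has mass `1/4`, which the coin splits evenly. The pairs
    -- with `X₁ = 0` contribute nothing, since `Y₂ = V` there.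
    have hq : pairEntropy (1 / 8) (1 / 8) = Real.log 2 / 4 := by
      rw [pairEntropy_eq (by norm_num) (by norm_num) (by norm_num)]
      norm_num
      rw [show (1 / 2 : ℝ) = 2⁻¹ from one_div 2, Real.binEntropy_two_inv]
      ring
    have hz (x : ℝ) : pairEntropy x 0 = 0 ∧ pairEntropy 0 x = 0 := by simp [pairEntropy]
    have hlaw (v x z : Bool) : law p (fun ω => ((ω.1, ω.2.1.1), ω.2.2)) ((v, x), z)
        = if x then 1 / 8 else if z = v then 1 / 4 else 0 := by
      rw [h1]
      cases v <;> cases x <;> cases z <;>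
        simp [law_eq_sum_ite, productLaw, coinChannel, Fintype.sum_prod_type] <;> norm_num
    simp only [Fintype.sum_prod_type, Fintype.sum_bool, hlaw]
    simp only [reduceIte, Bool.false_eq_true, Bool.true_eq_false, hq, hz]
    ring
  have h6 : entropy p (fun ω => ω.2.1.1) = 1 :=
    entropy_bool_eq_one hp.2 _ ((hX1 true).trans (hX true))
  have h7 : entropy p (fun ω => ((ω.1, ω.2.1.1), ω.2.2))
      = entropy p (fun ω => (ω.1, ω.2.1.1)) + 1 / 2 := by
    apply mul_right_cancel₀ hl.ne'
    rw [h4, h5]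
    ring
  unfold condMutualInfo
  linarith

end CoinChannel

end CoopBC

/-! ### Assembly of the proposition -/

theorem proposition2 :
    -- without input constraint, strict inclusion occurs for a semi-orthogonal broadcast channel
    (∃ K : CoopBC.Channel (Bool × Bool) Bool,
      CoopBC.restrictedRegionNS (CoopBC.semiOrthogonal K) Set.univ ⊂
        CoopBC.regionNS (CoopBC.semiOrthogonal K) Set.univ) ∧
    -- the binary dirty-paper example, with the Hamming weight constraint on the second input
    (∀ (ε : ℝ) (hε : ε ∈ Set.Icc (0 : ℝ) (1 / 2)) (q : ℝ), q ∈ Set.Icc (0 : ℝ) (1 / 2) →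
      IsGreatest {R₁ : ℝ | ∃ R₂ : ℝ, (CoopBC.bscCapacity, R₁, R₂) ∈
        CoopBC.restrictedRegionNS (CoopBC.semiOrthogonal (CoopBC.dirtyPaper ε hε))
          (CoopBC.weightConstraint q)} CoopBC.bscCapacity ∧
      IsGreatest {R₁ : ℝ | ∃ R₂ : ℝ, (CoopBC.bscCapacity, R₁, R₂) ∈
        CoopBC.regionNS (CoopBC.semiOrthogonal (CoopBC.dirtyPaper ε hε))
          (CoopBC.weightConstraint q)} CoopBC.bscCapacity ∧
      (∀ R₂ : ℝ, (CoopBC.bscCapacity, CoopBC.bscCapacity, R₂) ∈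
        CoopBC.restrictedRegionNS (CoopBC.semiOrthogonal (CoopBC.dirtyPaper ε hε))
          (CoopBC.weightConstraint q) →
        R₂ ≤ CoopBC.gelfandPinskerCapacity (CoopBC.dirtyPaper ε hε) q) ∧
      (CoopBC.bscCapacity, CoopBC.bscCapacity,
          CoopBC.fullCSICapacity (CoopBC.dirtyPaper ε hε) q) ∈
        CoopBC.regionNS (CoopBC.semiOrthogonal (CoopBC.dirtyPaper ε hε))
          (CoopBC.weightConstraint q)) ∧
    -- for suitable noise level and weight constraint the inclusion is strict there as well
    (∃ (ε : ℝ) (hε : ε ∈ Set.Icc (0 : ℝ) (1 / 2)) (q : ℝ), q ∈ Set.Icc (0 : ℝ) (1 / 2) ∧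
      CoopBC.gelfandPinskerCapacity (CoopBC.dirtyPaper ε hε) q <
        CoopBC.fullCSICapacity (CoopBC.dirtyPaper ε hε) q ∧
      CoopBC.restrictedRegionNS (CoopBC.semiOrthogonal (CoopBC.dirtyPaper ε hε))
          (CoopBC.weightConstraint q) ⊂
        CoopBC.regionNS (CoopBC.semiOrthogonal (CoopBC.dirtyPaper ε hε))
          (CoopBC.weightConstraint q) ∧
      sSup {R₂ : ℝ | (CoopBC.bscCapacity, CoopBC.bscCapacity, R₂) ∈
        CoopBC.restrictedRegionNS (CoopBC.semiOrthogonal (CoopBC.dirtyPaper ε hε))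
          (CoopBC.weightConstraint q)} <
      sSup {R₂ : ℝ | (CoopBC.bscCapacity, CoopBC.bscCapacity, R₂) ∈
        CoopBC.regionNS (CoopBC.semiOrthogonal (CoopBC.dirtyPaper ε hε))
          (CoopBC.weightConstraint q)}) := by

  open CoopBC in
  refine ⟨⟨coinChannel, restrictedRegionNS_subset _ _, fun hsub => ?_⟩, fun ε hε q hq => ?_, ?_⟩
  · obtain ⟨a, ha, hle⟩ := exists_gelfandPinsker_coinChannel_le
    obtain ⟨hP, hX, -⟩ := isStateLaw_productLaw (q := 1 / 2) (by norm_num)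
    have h := hsub (condMutualInfo_mem_regionNS coinChannel Set.univ hP hX (Set.mem_univ _))
    rw [condMutualInfo_coinChannel] at h
    obtain ⟨𝒱, i, P, hP, hX, -, h⟩ := exists_le_of_mem_restrictedRegionNS h
    linarith [hle 𝒱 i P hP hX]
  · obtain ⟨hP, hX, hA⟩ := isStateLaw_productLaw hq
    have h0 := zero_mem_restrictedRegionNS (dirtyPaper ε hε) _ hP hX hA
    refine ⟨⟨⟨0, h0⟩, ?_⟩, ⟨⟨0, restrictedRegionNS_subset _ _ h0⟩, ?_⟩, fun R₂ h => ?_, ?_⟩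
    · rintro R₁ ⟨R₂, h⟩
      exact (le_of_mem_regionNS (restrictedRegionNS_subset _ _ h)).1
    · rintro R₁ ⟨R₂, h⟩
      exact (le_of_mem_regionNS h).1
    · obtain ⟨𝒱, _, P, hP, hX, hA, h⟩ := exists_le_of_mem_restrictedRegionNS h
      exact h.trans (gelfandPinsker_le_capacity _ ⟨hP, hX, hA⟩)
    · rw [fullCSICapacity_dirtyPaper hε hq, ← condMutualInfo_productLaw hε hq]
      exact condMutualInfo_mem_regionNS (dirtyPaper ε hε) _ hP hX hA
  -- The choice `ε = q = 1/4` is arbitrary: the capacity gap is strict for all `ε` and `q` in the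
  -- open interval `(0, 1/2)`.
  · have hε : (1 / 4 : ℝ) ∈ Set.Ioo (0 : ℝ) (1 / 2) := by norm_num
    have hε' := Set.Ioo_subset_Icc_self hε
    obtain ⟨hP, hX, hA⟩ := isStateLaw_productLaw hε'
    have hlt := gelfandPinskerCapacity_lt_fullCSICapacity hε hε
    have hmem := condMutualInfo_mem_regionNS (dirtyPaper (1 / 4) hε') _ hP hX hA
    rw [condMutualInfo_productLaw hε' hε', ← fullCSICapacity_dirtyPaper hε' hε'] at hmem
    have hub (R₂ : ℝ) (h : (bscCapacity, bscCapacity, R₂) ∈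
        restrictedRegionNS (semiOrthogonal (dirtyPaper (1 / 4) hε')) (weightConstraint (1 / 4))) :
        R₂ ≤ gelfandPinskerCapacity (dirtyPaper (1 / 4) hε') (1 / 4) := by
      obtain ⟨𝒱, _, P, hP, hX, hA, h⟩ := exists_le_of_mem_restrictedRegionNS h
      exact h.trans (gelfandPinsker_le_capacity _ ⟨hP, hX, hA⟩)
    refine ⟨1 / 4, hε', 1 / 4, hε', hlt, ⟨restrictedRegionNS_subset _ _, fun hsub => ?_⟩, ?_⟩
    · exact hlt.not_ge (hub _ (hsub hmem))
    -- The first supremum is at most the Gelfand-Pinsker capacity, over a nonempty set. The second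
    -- is at least the full-CSI capacity, over a set bounded by `1 + c`.
    · refine (csSup_le ⟨0, zero_mem_restrictedRegionNS _ _ hP hX hA⟩ hub).trans_lt
        (hlt.trans_le (le_csSup ⟨1 + bscCapacity, ?_⟩ hmem))
      exact fun R₂ h => (le_of_mem_regionNS h).2
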